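/- A composition is a finite (possibly empty) sequence $\alpha=(\alpha_1,\dots,\alpha_k)$ of positive integers, $\ell(\alpha)=k$, $|\alpha|=\sum_i\alpha_i$; its diagram has $\alpha_i$ left-justified cells in the $i$-th row from the bottom, and $(i,j)$ is the cell in row $i$ and column $j$. Write $\beta\subset\alpha$ if $\ell(\beta)\le\ell(\alpha)$ and $\beta_i\le\alpha_i$ for $1\le i\le\ell(\beta)$; the skew diagram $\alpha//\beta$ then consists of the cells of $\alpha$ not in $\beta$. An SSYRT of shape $\alpha//\beta$ is a filling $T$ of the cells of $\alpha//\beta$ with positive integers such that (1) the entries strictly increase along each row from left to right; (2) the entries in the leftmost column (column $1$) weakly decrease from top to bottom; (3) for all $1\le i<j\le\ell(\alpha)$ and $k\ge 1$, if $T(j,k)<T(i,k+1)$ then $T(j,k+1)\le T(i,k+1)$, where cells of $\beta$ are given the entry $0$ and cells outside $\alpha$ the entry $\infty$. Its weight is $x^T=\prod_i x_i^{v_i}$, with $v_i$ the number of entries of $T$ equal to $i$. An SYRT of shape $\alpha//\beta$ is an SSYRT in which each of $1,\dots,n$ appears exactly once, $n=|\alpha//\beta|$ being the number of cells; its reverse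 descent set $\hat D(T)\subseteq[n-1]$ is the set of all $i\in[n-1]$ such that $i+1$ appears in a column strictly to the right of the column of $i$. Let $QSym$ be the space of quasisymmetric functions over $\mathbb{Q}$ in $x_1,x_2,\dots$, let $M_\alpha=\sum_{i_1<\dots<i_k}x_{i_1}^{\alpha_1}\cdots x_{i_k}^{\alpha_k}$, and let $F_\alpha=\sum_{\beta}M_\beta$, summed over all refinements $\beta$ of $\alpha$, be the fundamental basis. For $S=\{s_1<\dots<s_k\}\subseteq[n-1]$ put $F_S=F_{\mathrm{comp}(S)}$ with $\mathrm{comp}(S)=(s_1,s_2-s_1,\dots,n-s_k)$ (the empty composition if $n=0$). The coproduct $\Delta:QSym\to QSym\otimes QSym$ is the linear map with $$\Delta F_\alpha=\sum_{\beta\gamma=\alpha\ \text{or}\ \beta\odot\gamma=\alpha}F_\beta\otimes F_\gamma,$$ where $\beta\gamma$ is concatenation and, for nonempty $\beta=(\beta_1,\dots,\beta_k)$ and $\gamma=(\gamma_1,\dots,\gamma_m)$, $\beta\odot\gamma=(\beta_1,\dots,\beta_{k-1},\beta_k+\gamma_1,\gamma_2,\dots,\gamma_m)$. Let $\mathcal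 R_\alpha=\sum_T x^T\in QSym$, summed over all SSYRT $T$ of shape $\alpha$ (that is, $\alpha//\emptyset$). Theorem. There is exactly one family $(\mathcal R_{\alpha//\beta})$ of elements of $QSym$, indexed by all pairs of compositions, such that for every composition $\alpha$ only finitely many $\mathcal R_{\alpha//\beta}$ are nonzero and $$\Delta\mathcal R_\alpha=\sum_\beta \mathcal R_\beta\otimes\mathcal R_{\alpha//\beta}.$$ For all compositions $\beta\subset\alpha$ it satisfies $$\mathcal R_{\alpha//\beta}=\sum_{T\in \mathrm{SSYRT}(\alpha//\beta)}x^T=\sum_{T\in \mathrm{SYRT}(\alpha//\beta)}F_{\hat D(T)}.$$ -/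

import Mathlib

open scoped TensorProduct

namespace YRS

/-! ### Compositions -/

/-- A (strong) composition: a finite sequence of positive integers. The empty composition is the
only composition of `0`. -/
abbrev Comp : Type := List ℕ+

/-- The weight `|α|`, the sum of the parts. -/
def size (α : Comp) : ℕ := (α.map (fun a : ℕ+ => (a : ℕ))).sum

/-- The part of `α` with index `r` (counted from `0`), read as `0` beyond the last part. -/
def part (α : Comp) (r : ℕ) : ℕ := (α.map (fun a : ℕ+ => (a : ℕ))).getD r 0

/-- `Contained β α` is the containment `β ⊂ α` of compositions (equality allowed). -/
def Contained (β α : Comp) : Prop :=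
  β.length ≤ α.length ∧ ∀ r, r < β.length → part β r ≤ part α r

/-- `β` is a refinement of `α`: cutting `β` into consecutive nonempty blocks and summing each
block gives `α`. -/
def Refines (β α : Comp) : Prop :=
  ∃ L : List Comp, (∀ l ∈ L, l ≠ []) ∧ L.flatten = β ∧
    L.map size = α.map (fun a : ℕ+ => (a : ℕ))

/-- `NearConcat β γ α` says that `β` and `γ` are nonempty and `α = β ⊙ γ`, the almost
concatenation, in which the last part of `β` and the first part of `γ` are added. -/
def NearConcat (β γ α : Comp) : Prop :=
  ∃ (β' : Comp) (b c : ℕ+) (γ' : Comp),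
    β = β' ++ [b] ∧ γ = c :: γ' ∧ α = β' ++ (b + c) :: γ'

/-- The pairs `(β, γ)` with `βγ = α` or `β ⊙ γ = α`. -/
def coprodPairs (α : Comp) : Set (Comp × Comp) :=
  {p | p.1 ++ p.2 = α ∨ NearConcat p.1 p.2 α}

/-- The composition `comp(S) = (s₁, s₂ - s₁, …, s_k - s_{k-1}, n - s_k)` of `n` attached to
`S = {s₁ < ⋯ < s_k} ⊆ [n-1]`. All the differences are positive, except for `n = 0`, where
dropping the difference `0` leaves the empty composition. -/
def compOfSet (n : ℕ) (S : Finset ℕ) : Comp :=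
  (List.zipWith (fun a b => a - b) (S.sort (· ≤ ·) ++ [n]) (0 :: S.sort (· ≤ ·))).filterMap
    (fun m => if h : 0 < m then some ⟨m, h⟩ else none)

@[simp] theorem size_nil : size [] = 0 := rfl

@[simp] theorem size_cons (a : ℕ+) (α : Comp) : size (a :: α) = a + size α := by
  simp [size]

@[simp] theorem size_append (α β : Comp) : size (α ++ β) = size α + size β := by
  simp [size]

theorem size_flatten (L : List Comp) : size L.flatten = (L.map size).sum := by
  induction L with
  | nil => simp
  | cons l L ih => simp [ih]

theorem length_le_size (α : Comp) : α.length ≤ size α := by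
  induction α with
  | nil => simp
  | cons a α ih =>
    have := a.pos
    simp only [List.length_cons, size_cons]
    omega

theorem finite_size_le (n : ℕ) : {α : Comp | size α ≤ n}.Finite := by
  induction n with
  | zero =>
    refine (Set.finite_singleton ([] : Comp)).subset fun α h => ?_
    have := length_le_size α
    have h' : size α ≤ 0 := h
    exact List.length_eq_zero_iff.1 (by omega)
  | succ n ih =>
    have hfin : {a : ℕ+ | (a : ℕ) ≤ n + 1}.Finite :=
      (Set.finite_Iic (⟨n + 1, n.succ_pos⟩ : ℕ+)).subset fun a h => h
    refine ((Set.finite_singleton ([] : Comp)).union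
      (Set.Finite.image2 (fun a l => a :: l) hfin ih)).subset ?_
    rintro (_ | ⟨a, l⟩) h
    · left; rfl
    · right
      have h' : size (a :: l) ≤ n + 1 := h
      have := a.pos
      rw [size_cons] at h'
      exact ⟨a, by show (a : ℕ) ≤ n + 1; omega, l, by show size l ≤ n; omega, rfl⟩

theorem coprodPairs_finite (α : Comp) : (coprodPairs α).Finite := by
  refine ((finite_size_le (size α)).prod (finite_size_le (size α))).subset ?_
  rintro ⟨β, γ⟩ (h | ⟨β', b, c, γ', h1, h2, h3⟩)
  · dsimp only at h
    subst h
    simp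
  · dsimp only at h1 h2
    subst h1 h2 h3
    simp only [Set.mem_prod, Set.mem_ofPred_eq, size_append, size_cons, size_nil, PNat.add_coe]
    omega

theorem Refines.size_eq {β α : Comp} (h : Refines β α) : size β = size α := by
  obtain ⟨L, -, rfl, h⟩ := h
  rw [size_flatten, h, size]

theorem refines_refl (α : Comp) : Refines α α := by
  refine ⟨α.map (fun a => [a]), by simp, ?_, ?_⟩
  · induction α with
    | nil => rfl
    | cons a α ih => simp [ih]
  · simp [Function.comp_def]

theorem Refines.length_le {β α : Comp} (h : Refines β α) : α.length ≤ β.length := by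
  obtain ⟨L, h0, rfl, h⟩ := h
  have h1 : α.length = L.length := by simpa using (congrArg List.length h).symm
  rw [h1]
  clear h h1
  induction L with
  | nil => simp
  | cons l L ih =>
    have hl : 0 < l.length := List.length_pos_iff.2 (h0 l (by simp))
    have := ih fun l' h' => h0 l' (by simp [h'])
    simp only [List.flatten_cons, List.length_append, List.length_cons]
    omega

theorem Refines.eq_of_length_le {β α : Comp} (h : Refines β α) (hl : β.length ≤ α.length) :
    β = α := by
  obtain ⟨L, h0, rfl, h⟩ := h
  induction L generalizing α with
  | nil => simpa using h
  | cons l L ih =>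
    cases α with
    | nil => simp at h
    | cons a α =>
      simp only [List.map_cons, List.cons.injEq] at h
      have hle : α.length ≤ L.flatten.length :=
        Refines.length_le ⟨L, fun l' h' => h0 l' (by simp [h']), rfl, h.2⟩
      have hpos : 0 < l.length := List.length_pos_iff.2 (h0 l (by simp))
      simp only [List.flatten_cons, List.length_append, List.length_cons] at hl
      have e := ih (fun l' h' => h0 l' (by simp [h'])) h.2 (by omega)
      have hl1 : l.length = 1 := by omega
      obtain ⟨b, rfl⟩ := List.length_eq_one_iff.1 hl1
      have hb : b = a := PNat.coe_injective (by simpa using h.1)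
      simp [e, hb]

theorem refines_finite (α : Comp) : {β : Comp | Refines β α}.Finite :=
  (finite_size_le (size α)).subset fun _ h => (Refines.size_eq h).le

/-! ### Quasisymmetric functions -/

/-- The formal sum `∑ₓ x^{w x}` of the monomials with exponents `w x`, in the variables
`x₁, x₂, …`: the coefficient of `x^d` is the number of `x` with `w x = d`. (It is only used for
weights `w` with finite fibres.) -/
noncomputable def genFun {X : Type*} (w : X → (ℕ+ →₀ ℕ)) : MvPowerSeries ℕ+ ℚ :=
  fun d => (Nat.card {x : X // w x = d} : ℚ)

/-- The exponent of the monomial `x_{i₁}^{α₁} ⋯ x_{i_k}^{α_k}`, where `i₁ < ⋯ < i_k`. -/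
noncomputable def monoExp (α : Comp) (i : Fin α.length ↪o ℕ+) : ℕ+ →₀ ℕ :=
  ∑ j, Finsupp.single (i j) (α.get j : ℕ)

/-- The indices `1 < 2 < ⋯ < k`. -/
def firstVars (k : ℕ) : Fin k ↪o ℕ+ :=
  OrderEmbedding.ofStrictMono (fun j => Nat.succPNat j) fun _ _ h => Nat.succPNat_lt_succPNat.2 h

/-- The space of quasisymmetric functions over `ℚ`: power series of bounded degree in which the
coefficients of `x₁^{α₁} ⋯ x_k^{α_k}` and of `x_{i₁}^{α₁} ⋯ x_{i_k}^{α_k}` agree for every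
composition `α` and all `i₁ < ⋯ < i_k`. -/
def QSym : Submodule ℚ (MvPowerSeries ℕ+ ℚ) where
  carrier := {f | (∃ N : ℕ, ∀ d, MvPowerSeries.coeff d f ≠ 0 → d.degree ≤ N) ∧
    ∀ (α : Comp) (i : Fin α.length ↪o ℕ+),
      MvPowerSeries.coeff (monoExp α i) f = MvPowerSeries.coeff (monoExp α (firstVars _)) f}
  zero_mem' := ⟨⟨0, fun d h => absurd (by simp) h⟩, fun α i => by simp⟩
  add_mem' := by
    rintro f g ⟨⟨N, hN⟩, hf⟩ ⟨⟨K, hK⟩, hg⟩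
    refine ⟨⟨max N K, fun d h => ?_⟩, fun α i => by simp [hf α i, hg α i]⟩
    by_contra! hd
    refine h ?_
    have h1 : MvPowerSeries.coeff d f = 0 := by
      by_contra h'
      exact absurd (hN d h') (by have := le_max_left N K; omega)
    have h2 : MvPowerSeries.coeff d g = 0 := by
      by_contra h'
      exact absurd (hK d h') (by have := le_max_right N K; omega)
    simp [h1, h2]
  smul_mem' := by
    rintro c f ⟨⟨N, hN⟩, hf⟩
    refine ⟨⟨N, fun d h => hN d fun h' => h (by simp [h'])⟩, fun α i => by simp [hf α i]⟩

theorem monoExp_apply (α : Comp) (i : Fin α.length ↪o ℕ+) (j : Fin α.length) :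
    monoExp α i (i j) = (α.get j : ℕ) := by
  classical
  simp only [monoExp, Finsupp.coe_finsetSum, Finset.sum_apply, Finsupp.single_apply,
    EmbeddingLike.apply_eq_iff_eq, Finset.sum_ite_eq', Finset.mem_univ, if_true]

theorem monoExp_apply_of_notMem (α : Comp) (i : Fin α.length ↪o ℕ+) (v : ℕ+)
    (h : v ∉ Set.range i) : monoExp α i v = 0 := by
  classical
  simp only [monoExp, Finsupp.coe_finsetSum, Finset.sum_apply, Finsupp.single_apply]
  exact Finset.sum_eq_zero fun j _ => if_neg fun e => h ⟨j, e⟩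

theorem mem_support_monoExp (α : Comp) (i : Fin α.length ↪o ℕ+) (v : ℕ+) :
    v ∈ (monoExp α i).support ↔ v ∈ Set.range i := by
  rw [Finsupp.mem_support_iff]
  constructor
  · intro h
    by_contra h'
    exact h (monoExp_apply_of_notMem α i v h')
  · rintro ⟨j, rfl⟩
    rw [monoExp_apply]
    exact (α.get j).ne_zero

theorem degree_monoExp (α : Comp) (i : Fin α.length ↪o ℕ+) :
    (monoExp α i).degree = size α := by
  rw [monoExp, map_sum]
  simp only [Finsupp.degree_single, size]
  rw [← List.sum_ofFn]
  congr 1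
  conv_rhs => rw [← List.ofFn_get α, List.map_ofFn]
  rfl

/-- The nonzero exponents of `x^d`, in increasing order of the variables. -/
noncomputable def flat (d : ℕ+ →₀ ℕ) : List ℕ := (d.support.sort (· ≤ ·)).map d

theorem flat_monoExp (α : Comp) (i : Fin α.length ↪o ℕ+) :
    flat (monoExp α i) = α.map (fun a : ℕ+ => (a : ℕ)) := by
  have h : (monoExp α i).support.sort (· ≤ ·) = List.ofFn i := by
    have hs : (List.ofFn i).SortedLT := List.sortedLT_ofFn_iff.2 i.strictMono
    have : (monoExp α i).support = (List.ofFn i).toFinset := by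
      ext v
      rw [mem_support_monoExp]
      simp [List.mem_ofFn]
    rw [this]
    exact (List.toFinset_sort (· ≤ ·) hs.nodup).2 hs.sortedLE.pairwise
  rw [flat, h, List.map_ofFn]
  conv_rhs => rw [← List.ofFn_get α, List.map_ofFn]
  congr 1
  funext j
  exact monoExp_apply α i j

theorem monoExp_comp_injective {α β : Comp} {i : Fin α.length ↪o ℕ+} {j : Fin β.length ↪o ℕ+}
    (h : monoExp α i = monoExp β j) : α = β := by
  have := flat_monoExp α i
  rw [h, flat_monoExp] at this
  exact (List.map_injective_iff.2 PNat.coe_injective this).symm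

theorem monoExp_injective (α : Comp) : Function.Injective (monoExp α) := by
  intro i j h
  have hr : Set.range i = Set.range j := by
    ext v
    rw [← mem_support_monoExp, h, mem_support_monoExp]
  exact OrderEmbedding.range_inj.1 hr

theorem exists_monoExp (d : ℕ+ →₀ ℕ) :
    ∃ (α : Comp) (i : Fin α.length ↪o ℕ+), monoExp α i = d := by
  classical
  let e := d.support.orderEmbOfFin rfl
  have hpos : ∀ j, 0 < d (e j) := fun j =>
    Nat.pos_of_ne_zero (Finsupp.mem_support_iff.1 (Finset.orderEmbOfFin_mem _ _ j))
  let α : Comp := List.ofFn fun j : Fin d.support.card => (⟨d (e j), hpos j⟩ : ℕ+)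
  have hl : α.length = d.support.card := List.length_ofFn
  let i : Fin α.length ↪o ℕ+ := (Fin.castOrderIso hl).toOrderEmbedding.trans e
  refine ⟨α, i, ?_⟩
  ext v
  by_cases hv : v ∈ Set.range i
  · obtain ⟨j, rfl⟩ := hv
    rw [monoExp_apply]
    show ((α[(j : ℕ)] : ℕ+) : ℕ) = d (e (Fin.cast hl j))
    have hj : α[(j : ℕ)] = (⟨d (e (Fin.cast hl j)), hpos _⟩ : ℕ+) := List.getElem_ofFn _
    rw [hj]
    rfl
  · rw [monoExp_apply_of_notMem _ _ _ hv]
    by_contra h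
    refine hv ?_
    have : v ∈ Set.range e := by
      rw [Finset.range_orderEmbOfFin]
      exact Finsupp.mem_support_iff.2 (Ne.symm h)
    obtain ⟨k, rfl⟩ := this
    exact ⟨Fin.cast hl.symm k, by simp [i]⟩

/-- The power series `M_α = ∑_{i₁ < ⋯ < i_k} x_{i₁}^{α₁} ⋯ x_{i_k}^{α_k}`. -/
noncomputable def monoSeries (α : Comp) : MvPowerSeries ℕ+ ℚ := genFun (monoExp α)

theorem coeff_monoSeries (α β : Comp) (i : Fin β.length ↪o ℕ+) :
    MvPowerSeries.coeff (monoExp β i) (monoSeries α) = if β = α then 1 else 0 := by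
  show ((Nat.card {x : Fin α.length ↪o ℕ+ // monoExp α x = monoExp β i} : ℕ) : ℚ) = _
  split_ifs with h
  · subst h
    have : Nat.card {x : Fin β.length ↪o ℕ+ // monoExp β x = monoExp β i} = 1 := by
      rw [Nat.card_eq_one_iff_unique]
      exact ⟨⟨fun x y => Subtype.ext (monoExp_injective β (x.2.trans y.2.symm))⟩, ⟨⟨i, rfl⟩⟩⟩
    rw [this, Nat.cast_one]
  · have : IsEmpty {x : Fin α.length ↪o ℕ+ // monoExp α x = monoExp β i} :=
      ⟨fun x => h (monoExp_comp_injective x.2).symm⟩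
    rw [Nat.card_of_isEmpty, Nat.cast_zero]

theorem monoSeries_mem (α : Comp) : monoSeries α ∈ QSym := by
  refine ⟨⟨size α, fun d h => ?_⟩, fun β i => by rw [coeff_monoSeries, coeff_monoSeries]⟩
  obtain ⟨β, i, rfl⟩ := exists_monoExp d
  rw [coeff_monoSeries] at h
  have : β = α := by
    by_contra h'
    exact h (if_neg h')
  rw [degree_monoExp, this]

/-- The monomial quasisymmetric function `M_α`. -/
noncomputable def M (α : Comp) : QSym := ⟨monoSeries α, monoSeries_mem α⟩

/-- Gessel's fundamental quasisymmetric function `F_α`, the sum of the `M_β` over all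
refinements `β` of `α`. -/
noncomputable def F (α : Comp) : QSym := ∑ β ∈ (refines_finite α).toFinset, M β

/-- The coefficient of `x₁^{α₁} ⋯ x_k^{α_k}`. -/
noncomputable def coord (α : Comp) : QSym →ₗ[ℚ] ℚ :=
  (MvPowerSeries.coeff (monoExp α (firstVars _))).comp QSym.subtype

theorem coord_M (α β : Comp) : coord β (M α) = if β = α then 1 else 0 :=
  coeff_monoSeries α β _

open Classical in
theorem coord_F (α β : Comp) : coord β (F α) = if Refines β α then 1 else 0 := by
  rw [F, map_sum]
  simp [coord_M]

theorem qsym_ext {f g : QSym} (h : ∀ α, coord α f = coord α g) : f = g := by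
  apply Subtype.ext
  ext d
  obtain ⟨α, i, rfl⟩ := exists_monoExp d
  rw [f.2.2 α i, g.2.2 α i]
  exact h α

theorem mem_span_M (f : QSym) : f ∈ Submodule.span ℚ (Set.range M) := by
  obtain ⟨N, hN⟩ := f.2.1
  have : f = ∑ α ∈ (finite_size_le N).toFinset, coord α f • M α := by
    apply qsym_ext
    intro β
    rw [map_sum]
    simp only [map_smul, coord_M, smul_eq_mul, mul_ite, mul_one, mul_zero, Finset.sum_ite_eq,
      Set.Finite.mem_toFinset, Set.mem_ofPred_eq]
    split_ifs with h
    · rfl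
    · by_contra h'
      refine h ?_
      have := hN _ h'
      rwa [degree_monoExp] at this
  rw [this]
  exact Submodule.sum_mem _ fun α _ =>
    Submodule.smul_mem _ _ (Submodule.subset_span ⟨α, rfl⟩)

theorem M_mem_span_F (n : ℕ) (α : Comp) (h : size α - α.length ≤ n) :
    M α ∈ Submodule.span ℚ (Set.range F) := by
  classical
  induction n generalizing α with
  | zero =>
    have : F α = M α := by
      rw [F, Finset.sum_eq_single α]
      · intro β hβ hne
        have hβ' : Refines β α := by simpa using hβ
        have h1 := length_le_size β
        have h2 := hβ'.size_eq
        exact absurd (hβ'.eq_of_length_le (by omega)) hne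
      · intro h'
        exact absurd (by simpa using refines_refl α) h'
    rw [← this]
    exact Submodule.subset_span ⟨α, rfl⟩
  | succ n ih =>
    have hF : F α = M α + ∑ β ∈ (refines_finite α).toFinset.erase α, M β := by
      rw [F, Finset.add_sum_erase _ _ (by simpa using refines_refl α)]
    rw [eq_sub_of_add_eq hF.symm]
    refine Submodule.sub_mem _ (Submodule.subset_span ⟨α, rfl⟩)
      (Submodule.sum_mem _ fun β hβ => ih β ?_)
    rw [Finset.mem_erase] at hβ
    have hβ' : Refines β α := by simpa using hβ.2
    have h2 := hβ'.size_eq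
    have h3 : α.length < β.length := by
      by_contra h'
      exact hβ.1 (hβ'.eq_of_length_le (by omega))
    omega

theorem span_F : ⊤ ≤ Submodule.span ℚ (Set.range F) := by
  intro f _
  refine Submodule.span_le.2 ?_ (mem_span_M f)
  rintro _ ⟨α, rfl⟩
  exact M_mem_span_F _ α le_rfl

theorem linearIndependent_F : LinearIndependent ℚ F := by
  classical
  rw [linearIndependent_iff]
  intro l hl
  by_contra hne
  have hs : l.support.Nonempty := Finsupp.support_nonempty_iff.2 hne
  obtain ⟨α, hα, hmin⟩ := Finset.exists_min_image l.support (fun γ : Comp => γ.length) hs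
  have h := congrArg (coord α) hl
  rw [Finsupp.linearCombination_apply, Finsupp.sum, map_sum, Finset.sum_eq_single α] at h
  · simp only [map_smul, coord_F, if_pos (refines_refl α), map_zero, smul_eq_mul, mul_one] at h
    exact Finsupp.mem_support_iff.1 hα h
  · intro β hβ hne'
    have : ¬ Refines α β := fun hr => hne' (hr.eq_of_length_le (hmin β hβ)).symm
    simp [coord_F, this]
  · intro h'
    exact absurd hα h'

/-- The fundamental quasisymmetric functions as a basis of `QSym`. -/
noncomputable def basisF : Module.Basis Comp ℚ QSym :=
  Module.Basis.mk linearIndependent_F span_F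

/-- The coproduct of `QSym`: the linear map with
`Δ F_α = ∑ F_β ⊗ F_γ` over the pairs with `βγ = α` or `β ⊙ γ = α`. -/
noncomputable def Δ : QSym →ₗ[ℚ] QSym ⊗[ℚ] QSym :=
  basisF.constr ℚ fun α => ∑ p ∈ (coprodPairs_finite α).toFinset, F p.1 ⊗ₜ[ℚ] F p.2

theorem Δ_F (α : Comp) :
    Δ (F α) = ∑ p ∈ (coprodPairs_finite α).toFinset, F p.1 ⊗ₜ[ℚ] F p.2 := by
  have h : F α = basisF α := by simp [basisF]
  rw [h, Δ, Module.Basis.constr_basis]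

/-! ### Composition tableaux -/

/-- The cells of the skew diagram `α // β`, as pairs (row, column), both counted from `0`, rows
from the bottom (French convention) and columns from the left. -/
def skewCells (α β : Comp) : Finset ((_ : ℕ) × ℕ) :=
  (Finset.range α.length).sigma fun r => Finset.Ico (part β r) (part α r)

/-- A filling of `α // β` with positive integers. -/
abbrev Filling (α β : Comp) : Type := skewCells α β → ℕ+

/-- The entry in row `r` and column `c`: `∞` outside the diagram of `α`, and `0` in the cells
of `β`. -/
def entry {α β : Comp} (T : Filling α β) (r c : ℕ) : ℕ∞ :=
  if h : (⟨r, c⟩ : (_ : ℕ) × ℕ) ∈ skewCells α β then ((T ⟨⟨r, c⟩, h⟩ : ℕ+) : ℕ)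
  else if c < part α r then 0 else ⊤

/-- `T` is a semi-standard Young row-strict composition tableau of shape `α // β`. In the triple
condition there is no upper bound on the column `k`, since for `k + 1` beyond the longest row
`entry T i (k + 1) = ∞`. -/
structure IsSSYRT {α β : Comp} (T : Filling α β) : Prop where
  /-- Rows strictly increase from left to right. -/
  row : ∀ x y : skewCells α β, x.1.1 = y.1.1 → x.1.2 < y.1.2 → T x < T y
  /-- The leftmost column weakly decreases from top to bottom. -/
  col : ∀ x y : skewCells α β, x.1.2 = 0 → y.1.2 = 0 → x.1.1 < y.1.1 → T x ≤ T y
  /-- The triple condition. -/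
  triple : ∀ i j k : ℕ, i < j → j < α.length →
    entry T j k < entry T i (k + 1) → entry T j (k + 1) ≤ entry T i (k + 1)

/-- `|α // β|`, the number of cells. -/
def skewSize (α β : Comp) : ℕ := (skewCells α β).card

/-- `T` is standard: the entries are `1, 2, …, |α // β|`, each appearing exactly once. -/
structure IsSYRT {α β : Comp} (T : Filling α β) : Prop extends IsSSYRT T where
  inj : Function.Injective T
  range : Set.range T = {v : ℕ+ | (v : ℕ) ≤ skewSize α β}

/-- The set of SSYRT of shape `α // β`. -/
abbrev SSYRT (α β : Comp) : Type := {T : Filling α β // IsSSYRT T}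

/-- The set of SYRT of shape `α // β`. -/
abbrev SYRT (α β : Comp) : Type := {T : Filling α β // IsSYRT T}

/-- The exponent of the weight `x^T = ∏ xᵢ^{vᵢ}`, where `vᵢ` is the number of entries `i`. -/
noncomputable def weight {α β : Comp} (T : Filling α β) : ℕ+ →₀ ℕ :=
  ∑ x, Finsupp.single (T x) 1

open Classical in
/-- The reverse descent set: the `i ∈ [n-1]`, `n = |α // β|`, such that `i + 1` appears in a
column strictly to the right of `i`. -/
noncomputable def revDes {α β : Comp} (T : Filling α β) : Finset ℕ :=
  (Finset.Icc 1 (skewSize α β - 1)).filter fun i =>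
    ∃ x y : skewCells α β, (T x : ℕ) = i ∧ (T y : ℕ) = i + 1 ∧ x.1.2 < y.1.2

/-- The generating function `∑ x^T` of the SSYRT `T` of shape `α // β`. -/
noncomputable def ssyrtGenFun (α β : Comp) : MvPowerSeries ℕ+ ℚ :=
  genFun fun T : SSYRT α β => weight T.1

theorem mem_support_weight {α β : Comp} (T : Filling α β) (x : skewCells α β) :
    T x ∈ (weight T).support := by
  classical
  rw [Finsupp.mem_support_iff, weight, Finsupp.finsetSum_apply]
  intro h
  have := (Finset.sum_eq_zero_iff.1 h) x (Finset.mem_univ x)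
  simp at this

theorem degree_weight {α β : Comp} (T : Filling α β) : (weight T).degree = skewSize α β := by
  rw [weight, map_sum]
  simp [skewSize]

theorem weight_relabel {α β : Comp} (T : Filling α β) (φ : ℕ+ → ℕ+) :
    weight (φ ∘ T) = (weight T).mapDomain φ := by
  simp [weight, Finsupp.mapDomain_finsetSum, Finsupp.mapDomain_single]

/-- Only finitely many SSYRT of a given shape have a given weight. -/
instance finite_weight_fibre (α β : Comp) (d : ℕ+ →₀ ℕ) :
    Finite {T : SSYRT α β // weight T.1 = d} := by
  refine Finite.of_injective
    (fun (T : {T : SSYRT α β // weight T.1 = d}) (x : skewCells α β) =>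
      (⟨T.1.1 x, by
        have h := mem_support_weight T.1.1 x
        rwa [T.2] at h⟩ : d.support)) ?_
  intro T T' h
  apply Subtype.ext
  apply Subtype.ext
  funext x
  exact congrArg Subtype.val (congrFun h x)

instance finite_SYRT (α β : Comp) : Finite (SYRT α β) := by
  have hfin : {v : ℕ+ | (v : ℕ) ≤ skewSize α β}.Finite :=
    (Set.finite_Iic (Nat.succPNat (skewSize α β))).subset fun v (h : (v : ℕ) ≤ _) => by
      show (v : ℕ) ≤ (Nat.succPNat (skewSize α β) : ℕ)
      rw [Nat.succPNat_coe]
      omega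
  have : Finite {v : ℕ+ | (v : ℕ) ≤ skewSize α β} := hfin
  refine Finite.of_injective
    (fun (T : SYRT α β) (x : skewCells α β) =>
      (⟨T.1 x, by
        have h := Set.mem_range_self (f := T.1) x
        rwa [T.2.range] at h⟩ : {v : ℕ+ | (v : ℕ) ≤ skewSize α β})) ?_
  intro T T' h
  apply Subtype.ext
  funext x
  exact congrArg Subtype.val (congrFun h x)

noncomputable instance fintype_SYRT (α β : Comp) : Fintype (SYRT α β) := Fintype.ofFinite _

theorem IsSSYRT.relabel {α β : Comp} {T : Filling α β} (hT : IsSSYRT T) (φ : ℕ+ → ℕ+)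
    (hφ : ∀ x y, T x < T y ↔ φ (T x) < φ (T y)) : IsSSYRT (φ ∘ T) := by
  have hlt : ∀ r c r' c',
      entry (φ ∘ T) r c < entry (φ ∘ T) r' c' ↔ entry T r c < entry T r' c' := by
    intro r c r' c'
    unfold entry
    split_ifs with h1 h2 h3 h4 h5 h6 h7 <;>
      simp [← hφ]
  refine ⟨fun x y h h' => (hφ x y).1 (hT.row x y h h'), fun x y h h' h'' => ?_, ?_⟩
  · exact not_lt.1 fun hc => not_lt.2 (hT.col x y h h' h'') ((hφ y x).2 hc)
  · intro i j k hij hj h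
    rw [hlt] at h
    exact not_lt.1 fun hc => not_lt.2 (hT.triple i j k hij hj h) ((hlt _ _ _ _).1 hc)

theorem relabel_aux {α β γ : Comp} (i i' : Fin γ.length ↪o ℕ+) {T : Filling α β}
    (hT : IsSSYRT T) (hw : weight T = monoExp γ i) :
    IsSSYRT (Function.extend i i' id ∘ T) ∧
      weight (Function.extend i i' id ∘ T) = monoExp γ i' := by
  have hφ : ∀ j, Function.extend i i' id (i j) = i' j := i.injective.extend_apply _ _
  constructor
  · refine hT.relabel _ fun x y => ?_
    obtain ⟨a, ha⟩ := (mem_support_monoExp γ i _).1 (hw ▸ mem_support_weight T x)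
    obtain ⟨b, hb⟩ := (mem_support_monoExp γ i _).1 (hw ▸ mem_support_weight T y)
    rw [← ha, ← hb, hφ, hφ, i.lt_iff_lt, i'.lt_iff_lt]
  · rw [weight_relabel, hw, monoExp, Finsupp.mapDomain_finsetSum]
    simp [Finsupp.mapDomain_single, hφ, monoExp]

theorem relabel_inv {α β γ : Comp} (i i' : Fin γ.length ↪o ℕ+) {T : Filling α β}
    (hw : weight T = monoExp γ i) :
    Function.extend i' i id ∘ (Function.extend i i' id ∘ T) = T := by
  funext x
  obtain ⟨a, ha⟩ := (mem_support_monoExp γ i _).1 (hw ▸ mem_support_weight T x)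
  simp only [Function.comp_apply, ← ha, i.injective.extend_apply, i'.injective.extend_apply]

theorem ssyrtGenFun_mem (α β : Comp) : ssyrtGenFun α β ∈ QSym := by
  refine ⟨⟨skewSize α β, fun d h => ?_⟩, fun γ i => ?_⟩
  · have h' : ((Nat.card {T : SSYRT α β // weight T.1 = d} : ℕ) : ℚ) ≠ 0 := h
    rw [Nat.cast_ne_zero] at h'
    obtain ⟨T, hT⟩ := (Nat.card_ne_zero.1 h').1
    rw [← hT, degree_weight]
  · show ((Nat.card {T : SSYRT α β // weight T.1 = monoExp γ i} : ℕ) : ℚ) =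
      ((Nat.card {T : SSYRT α β // weight T.1 = monoExp γ (firstVars _)} : ℕ) : ℚ)
    congr 1
    exact Nat.card_congr
      { toFun := fun T => ⟨⟨_, (relabel_aux i (firstVars _) T.1.2 T.2).1⟩,
          (relabel_aux i (firstVars _) T.1.2 T.2).2⟩
        invFun := fun T => ⟨⟨_, (relabel_aux (firstVars _) i T.1.2 T.2).1⟩,
          (relabel_aux (firstVars _) i T.1.2 T.2).2⟩
        left_inv := fun T => Subtype.ext (Subtype.ext (relabel_inv i (firstVars _) T.2))
        right_inv := fun T => Subtype.ext (Subtype.ext (relabel_inv (firstVars _) i T.2)) }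

/-- The Young row-strict quasisymmetric Schur function `R_α`, the generating function of the
SSYRT of (straight) shape `α`. -/
noncomputable def R (α : Comp) : QSym := ⟨ssyrtGenFun α [], ssyrtGenFun_mem α []⟩

/-- `S α β` is the skew Young row-strict quasisymmetric Schur function `R_{α // β}` for all
compositions `α`, `β`: for each `α` only finitely many `S α β` are nonzero, and
`Δ R_α = ∑_β R_β ⊗ S α β`, the sum over all compositions `β`. -/
def IsSkewFamily (S : Comp → Comp →₀ QSym) : Prop :=
  ∀ α, Δ (R α) = (S α).sum fun β g => R β ⊗ₜ[ℚ] g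

end YRS

/-! Work in monomial coordinates. For every m ≤ |α|, exactly one pair (β, γ) with βγ = α or β ⊙ γ =
α has |β| = m, and βγ is then α with an additional cut at m. Since refinement is containment of
partial sums, the sum defining Δ is dual to concatenation: the M_γ ⊗ M_δ coordinate of Δf is the
M_{γδ} coordinate of f (`coord₂_Δ`).

For the generating function of the SSYRT, the M_{γδ} coordinate counts tableaux of shape α and
content γδ. Cut such a tableau at the threshold ℓ(γ). The small entries fill a composition diagram β
and form an SSYRT of content γ; the large ones, lowered by ℓ(γ), form an SSYRT of shape α//β and
content δ. Conversely any two such tableaux glue: the conventions 0 on β and ∞ outside α are what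
makes the triple condition compatible with cutting and gluing. Hence Δ R_α = ∑ R_β ⊗ R_{α//β}, with
R_{α//β} the SSYRT generating function (`card_ssyrt_append`, `Δ_R`).

Uniqueness of the family amounts to linear independence of the R_β (`linearIndependent_R`). Fill α
with 1, 2, … row by row. A standard tableau of shape β with the same size and the same reverse
descent set has its entries in columns at least as far to the right, so the column sum of β is at
least that of α, with equality only for β = α (`eq_of_revDes_eq`). Expanded in the fundamental
basis, the R_β are therefore triangular with respect to the column sum.

The fundamental expansion is standardization. Equal entries are ordered by columns from right to
left, upwards in the first column and downwards in the others. This matches SSYRT of content γ with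
SYRT whose reverse descents are partial sums of γ (`card_ssyrt_of_count`), which is the condition
for M_γ to occur in the corresponding F. -/

namespace YRS

/-! ### Partial sums of compositions and refinement -/

/-- The partial sums of a composition: the sizes of its prefixes. -/
def cuts (α : Comp) : Set ℕ := {m | ∃ β γ, α = β ++ γ ∧ m = size β}

theorem zero_mem_cuts (α : Comp) : 0 ∈ cuts α := ⟨[], α, rfl, rfl⟩

theorem size_mem_cuts (α : Comp) : size α ∈ cuts α := ⟨α, [], by simp, rfl⟩

theorem le_size_of_mem_cuts {α : Comp} {m : ℕ} (h : m ∈ cuts α) : m ≤ size α := by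
  obtain ⟨β, γ, rfl, rfl⟩ := h
  simp

theorem cuts_nil : cuts [] = {0} := by
  ext m
  constructor
  · intro h
    simpa using le_size_of_mem_cuts h
  · rintro rfl
    exact zero_mem_cuts _

theorem cuts_cons (a : ℕ+) (α : Comp) :
    cuts (a :: α) = insert 0 ((fun m => (a : ℕ) + m) '' cuts α) := by
  ext m
  constructor
  · rintro ⟨β, γ, h, rfl⟩
    cases β with
    | nil => left; rfl
    | cons b β =>
      simp only [List.cons_append, List.cons.injEq] at h
      obtain ⟨rfl, rfl⟩ := h
      right
      exact ⟨size β, ⟨β, γ, rfl, rfl⟩, by simp⟩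
  · rintro (rfl | ⟨_, ⟨β, γ, rfl, rfl⟩, rfl⟩)
    · exact zero_mem_cuts _
    · exact ⟨a :: β, γ, rfl, by simp⟩

theorem mem_cuts_append {α β : Comp} {m : ℕ} :
    m ∈ cuts (α ++ β) ↔ m ∈ cuts α ∨ ∃ l ∈ cuts β, m = size α + l := by
  induction α generalizing m with
  | nil =>
    simp only [List.nil_append, cuts_nil, Set.mem_singleton_iff, size_nil, zero_add]
    constructor
    · exact fun h => Or.inr ⟨m, h, rfl⟩
    · rintro (rfl | ⟨l, h, rfl⟩)
      · exact zero_mem_cuts _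
      · exact h
  | cons a α ih =>
    simp only [List.cons_append, cuts_cons, Set.mem_insert_iff, Set.mem_image, ih, size_cons]
    constructor
    · rintro (h | ⟨l, h | ⟨k, hk, rfl⟩, rfl⟩)
      · exact Or.inl (Or.inl h)
      · exact Or.inl (Or.inr ⟨l, h, rfl⟩)
      · exact Or.inr ⟨k, hk, by omega⟩
    · rintro ((h | ⟨l, h, rfl⟩) | ⟨k, hk, rfl⟩)
      · exact Or.inl h
      · exact Or.inr ⟨l, Or.inl h, rfl⟩
      · exact Or.inr ⟨_, Or.inr ⟨k, hk, rfl⟩, by omega⟩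

theorem Refines.cuts_subset {β α : Comp} (h : Refines β α) : cuts α ⊆ cuts β := by
  obtain ⟨L, -, rfl, h⟩ := h
  induction L generalizing α with
  | nil =>
    have : α = [] := by simpa using h.symm
    subst this
    exact subset_rfl
  | cons l L ih =>
    cases α with
    | nil => simp at h
    | cons a α =>
      simp only [List.map_cons, List.cons.injEq] at h
      intro m hm
      rw [cuts_cons] at hm
      rw [List.flatten_cons, mem_cuts_append]
      rcases hm with rfl | ⟨k, hk, rfl⟩
      · exact Or.inl (zero_mem_cuts _)
      · exact Or.inr ⟨k, ih h.2 hk, by rw [h.1]⟩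

theorem eq_nil_of_size_eq_zero {α : Comp} (h : size α = 0) : α = [] := by
  have := length_le_size α
  exact List.length_eq_zero_iff.1 (by omega)

/-- The first part of α is a partial sum of β, so a prefix of β sums to it; the later partial sums
of α, shifted by that part, are partial sums of the rest of β. -/
theorem refines_of_cuts_subset {β α : Comp} (hs : size β = size α) (h : cuts α ⊆ cuts β) :
    Refines β α := by
  induction α generalizing β with
  | nil =>
    rw [eq_nil_of_size_eq_zero (hs.trans size_nil)]
    exact refines_refl _
  | cons a α ih =>
    have ha : (a : ℕ) ∈ cuts (a :: α) := by
      rw [cuts_cons]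
      exact Or.inr ⟨0, zero_mem_cuts _, rfl⟩
    obtain ⟨γ, δ, rfl, hγ⟩ := h ha
    have hδ : size δ = size α := by
      simp only [size_append, size_cons] at hs
      omega
    obtain ⟨L, h0, h1, h2⟩ := ih hδ fun m hm => by
      have : (a : ℕ) + m ∈ cuts (a :: α) := by
        rw [cuts_cons]
        exact Or.inr ⟨m, hm, rfl⟩
      rcases mem_cuts_append.1 (h this) with h' | ⟨l, hl, h'⟩
      · have := le_size_of_mem_cuts h'
        have : m = 0 := by omega
        rw [this]
        exact zero_mem_cuts _
      · have : m = l := by omega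
        rwa [this]
    refine ⟨γ :: L, ?_, by simp [h1], by simp [h2, hγ]⟩
    rintro l (_ | ⟨_, hl⟩) rfl
    · have := a.pos
      rw [size_nil] at hγ
      omega
    · exact h0 _ hl rfl

theorem refines_iff {β α : Comp} : Refines β α ↔ size β = size α ∧ cuts α ⊆ cuts β :=
  ⟨fun h => ⟨h.size_eq, h.cuts_subset⟩, fun h => refines_of_cuts_subset h.1 h.2⟩

theorem cuts_injective : Function.Injective cuts := by
  intro α β h
  have hs : size α = size β :=
    le_antisymm (le_size_of_mem_cuts (h ▸ size_mem_cuts α))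
      (le_size_of_mem_cuts (h ▸ size_mem_cuts β))
  have h1 : Refines α β := refines_of_cuts_subset hs h.ge
  have h2 : Refines β α := refines_of_cuts_subset hs.symm h.le
  exact h1.eq_of_length_le h2.length_le

theorem append_left_inj_of_size {α β γ δ : Comp} (h : α ++ β = γ ++ δ) (hs : size α = size γ) :
    α = γ ∧ β = δ := by
  induction α generalizing γ with
  | nil =>
    have := eq_nil_of_size_eq_zero (hs.symm.trans size_nil)
    subst this
    exact ⟨rfl, h⟩
  | cons a α ih =>
    cases γ with
    | nil =>
      have := a.pos
      simp at hs
    | cons c γ =>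
      simp only [List.cons_append, List.cons.injEq] at h
      obtain ⟨rfl, h⟩ := h
      obtain ⟨rfl, rfl⟩ := ih h (by simpa using hs)
      exact ⟨rfl, rfl⟩

/-! ### The composition of a set -/

/-- A natural number as a part of a composition, if it is positive. -/
def toPart (m : ℕ) : Option ℕ+ := if h : 0 < m then some ⟨m, h⟩ else none

/-- A zero difference only repeats a partial sum, so dropping it changes neither the size nor the
cuts. This disposes of the case n = 0 of `compOfSet` without a separate argument. -/
theorem filterMap_toPart_cons (b : ℕ) (l : List ℕ) :
    size ((b :: l).filterMap toPart) = b + size (l.filterMap toPart) ∧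
    ∀ m, m ∈ cuts ((b :: l).filterMap toPart) ↔
      m = 0 ∨ ∃ k ∈ cuts (l.filterMap toPart), b + k = m := by
  by_cases hb : 0 < b
  · have : (b :: l).filterMap toPart = Nat.toPNat b hb :: l.filterMap toPart :=
      List.filterMap_cons_some (by rw [toPart, dif_pos hb]; rfl)
    rw [this, cuts_cons]
    exact ⟨size_cons _ _, fun m => Iff.rfl⟩
  · have : (b :: l).filterMap toPart = l.filterMap toPart :=
      List.filterMap_cons_none (by simp [toPart, hb])
    obtain rfl : b = 0 := by omega
    rw [this]
    refine ⟨by omega, fun m => ⟨fun h => Or.inr ⟨m, h, by omega⟩, ?_⟩⟩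
    rintro (rfl | ⟨k, hk, rfl⟩)
    · exact zero_mem_cuts _
    · simpa using hk

/-- The differences telescope. The starting value a is arbitrary for the sake of the induction; only
a = 0 is needed afterwards. -/
theorem cuts_differences (n : ℕ) (l : List ℕ) (a : ℕ) (h : (a :: (l ++ [n])).Pairwise (· ≤ ·)) :
    a + size ((List.zipWith (fun a b => a - b) (l ++ [n]) (a :: l)).filterMap toPart) = n ∧
    ∀ m, m ∈ cuts ((List.zipWith (fun a b => a - b) (l ++ [n]) (a :: l)).filterMap toPart) ↔
      a + m = a ∨ a + m ∈ l ∨ a + m = n := by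
  induction l generalizing a with
  | nil =>
    simp only [List.nil_append, List.pairwise_cons, List.mem_singleton, forall_eq] at h
    simp only [List.nil_append, List.zipWith_cons_cons, List.zipWith_nil_right,
      filterMap_toPart_cons, List.filterMap_nil, cuts_nil, size_nil, Set.mem_singleton_iff,
      exists_eq_left, List.not_mem_nil, false_or]
    have := h.1
    exact ⟨by omega, fun m => by omega⟩
  | cons b l ih =>
    simp only [List.cons_append] at h
    rw [List.pairwise_cons] at h
    have hab : a ≤ b := h.1 b (by simp)
    obtain ⟨h1, h2⟩ := ih b h.2
    have hle : ∀ c ∈ l, b ≤ c := fun c hc => (List.pairwise_cons.1 h.2).1 c (by simp [hc])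
    have hbn : b ≤ n := (List.pairwise_cons.1 h.2).1 n (by simp)
    simp only [List.cons_append, List.zipWith_cons_cons] at h1 h2 ⊢
    simp only [filterMap_toPart_cons (b - a), h2, List.mem_cons]
    refine ⟨by omega, fun m => ?_⟩
    constructor
    · rintro (rfl | ⟨k, hk, rfl⟩)
      · exact Or.inl rfl
      · have e : a + (b - a + k) = b + k := by omega
        rw [e]
        tauto
    · intro h
      rcases Nat.eq_zero_or_pos m with rfl | hm
      · exact Or.inl rfl
      · have hbm : b ≤ a + m := by
          rcases h with h | (h | h) | h
          · omega
          · omega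
          · exact hle _ h
          · omega
        refine Or.inr ⟨a + m - b, ?_, by omega⟩
        have e : b + (a + m - b) = a + m := by omega
        rw [e]
        rcases h with h | h | h
        · omega
        · tauto
        · tauto

theorem compOfSet_eq (n : ℕ) (S : Finset ℕ) : compOfSet n S =
    (List.zipWith (fun a b => a - b) (S.sort (· ≤ ·) ++ [n]) (0 :: S.sort (· ≤ ·))).filterMap
      toPart := rfl

theorem pairwise_sort_append {n : ℕ} {S : Finset ℕ} (h : ∀ s ∈ S, s ≤ n) :
    (0 :: (S.sort (· ≤ ·) ++ [n])).Pairwise (· ≤ ·) := by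
  rw [List.pairwise_cons, List.pairwise_append]
  exact ⟨fun _ _ => Nat.zero_le _, Finset.pairwise_sort _ _, by simp, by simpa using h⟩

theorem size_compOfSet {n : ℕ} {S : Finset ℕ} (h : ∀ s ∈ S, s ≤ n) :
    size (compOfSet n S) = n := by
  rw [compOfSet_eq]
  simpa using (cuts_differences n _ 0 (pairwise_sort_append h)).1

theorem mem_cuts_compOfSet {n : ℕ} {S : Finset ℕ} (h : ∀ s ∈ S, s ≤ n) {m : ℕ} :
    m ∈ cuts (compOfSet n S) ↔ m = 0 ∨ m ∈ S ∨ m = n := by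
  rw [compOfSet_eq]
  simpa using (cuts_differences n _ 0 (pairwise_sort_append h)).2 m

theorem refines_compOfSet_iff {n : ℕ} {S : Finset ℕ} (h : ∀ s ∈ S, s ≤ n) {γ : Comp} :
    Refines γ (compOfSet n S) ↔ size γ = n ∧ ∀ s ∈ S, s ∈ cuts γ := by
  rw [refines_iff, size_compOfSet h]
  refine and_congr_right fun hγ => ⟨fun h' s hs => h' ((mem_cuts_compOfSet h).2 (by tauto)), ?_⟩
  intro h' m hm
  rcases (mem_cuts_compOfSet h).1 hm with rfl | hm | rfl
  · exact zero_mem_cuts _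
  · exact h' m hm
  · rw [← hγ]
    exact size_mem_cuts γ

/-- The cuts are S together with 0 and n, and the two extra points can be removed again because S
lies strictly between them. -/
theorem compOfSet_inj {n n' : ℕ} {S S' : Finset ℕ} (hS : S ⊆ Finset.Icc 1 (n - 1))
    (hS' : S' ⊆ Finset.Icc 1 (n' - 1)) (h : compOfSet n S = compOfSet n' S') :
    n = n' ∧ S = S' := by
  have h1 : ∀ s ∈ S, 1 ≤ s ∧ s ≤ n - 1 := fun s hs => Finset.mem_Icc.1 (hS hs)
  have h2 : ∀ s ∈ S', 1 ≤ s ∧ s ≤ n' - 1 := fun s hs => Finset.mem_Icc.1 (hS' hs)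
  have h1' : ∀ s ∈ S, s ≤ n := fun s hs => by have := h1 s hs; omega
  have h2' : ∀ s ∈ S', s ≤ n' := fun s hs => by have := h2 s hs; omega
  have hn : n = n' := by rw [← size_compOfSet h1', h, size_compOfSet h2']
  subst hn
  refine ⟨rfl, ?_⟩
  ext m
  have hm : (m = 0 ∨ m ∈ S ∨ m = n) ↔ (m = 0 ∨ m ∈ S' ∨ m = n) := by
    rw [← mem_cuts_compOfSet h1', h, mem_cuts_compOfSet h2']
  constructor
  · intro hs
    have := h1 m hs
    rcases hm.1 (Or.inr (Or.inl hs)) with h | h | h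
    · omega
    · exact h
    · omega
  · intro hs
    have := h2 m hs
    rcases hm.2 (Or.inr (Or.inl hs)) with h | h | h
    · omega
    · exact h
    · omega

/-! ### The coproduct in the monomial basis -/

theorem size_of_mem_coprodPairs {α : Comp} {p : Comp × Comp} (hp : p ∈ coprodPairs α) :
    size p.1 + size p.2 = size α := by
  obtain ⟨β, γ⟩ := p
  rcases hp with h | ⟨β', b, c, γ', h1, h2, h3⟩
  · rw [← h, size_append]
  · dsimp only at h1 h2
    subst h1 h2 h3
    simp only [size_append, size_cons, size_nil, PNat.add_coe]
    omega

/-- Concatenation cuts α at an existing partial sum, almost concatenation in the interior of a part;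
both cases have this common description. -/
theorem mem_cuts_of_mem_coprodPairs {α : Comp} {p : Comp × Comp} (hp : p ∈ coprodPairs α)
    {m : ℕ} : m ∈ cuts (p.1 ++ p.2) ↔ m ∈ cuts α ∨ m = size p.1 := by
  obtain ⟨β, γ⟩ := p
  rcases hp with h | ⟨β', b, c, γ', h1, h2, h3⟩
  · dsimp only at h ⊢
    rw [← h]
    refine ⟨Or.inl, ?_⟩
    rintro (h | rfl)
    · exact h
    · exact ⟨β, γ, rfl, rfl⟩
  · dsimp only at h1 h2 ⊢
    subst h1 h2 h3
    simp only [mem_cuts_append, cuts_cons, cuts_nil, Set.mem_insert_iff, Set.mem_image,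
      Set.mem_singleton_iff, size_append, size_cons, size_nil, PNat.add_coe]
    constructor
    · rintro ((h | ⟨l, rfl | ⟨k, rfl, rfl⟩, rfl⟩) | ⟨l, rfl | ⟨k, hk, rfl⟩, rfl⟩)
      · exact Or.inl (Or.inl h)
      · exact Or.inl (Or.inr ⟨0, Or.inl rfl, rfl⟩)
      · exact Or.inr rfl
      · exact Or.inr rfl
      · exact Or.inl (Or.inr ⟨_, Or.inr ⟨k, hk, rfl⟩, by omega⟩)
    · rintro ((h | ⟨l, rfl | ⟨k, hk, rfl⟩, rfl⟩) | rfl)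
      · exact Or.inl (Or.inl h)
      · exact Or.inl (Or.inr ⟨0, Or.inl rfl, rfl⟩)
      · exact Or.inr ⟨_, Or.inr ⟨k, hk, rfl⟩, by omega⟩
      · exact Or.inr ⟨0, Or.inl rfl, by omega⟩

/-- The size of the first factor determines the cuts of the concatenation, hence the concatenation,
and also the place where it is divided. -/
theorem coprodPairs_unique {α : Comp} {p q : Comp × Comp} (hp : p ∈ coprodPairs α)
    (hq : q ∈ coprodPairs α) (h : size p.1 = size q.1) : p = q := by
  have : p.1 ++ p.2 = q.1 ++ q.2 := cuts_injective <| by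
    ext m
    rw [mem_cuts_of_mem_coprodPairs hp, mem_cuts_of_mem_coprodPairs hq, h]
  obtain ⟨h1, h2⟩ := append_left_inj_of_size this h
  exact Prod.ext h1 h2

theorem exists_mem_coprodPairs {α : Comp} {m : ℕ} (hm : m ≤ size α) :
    ∃ p ∈ coprodPairs α, size p.1 = m := by
  induction α generalizing m with
  | nil => exact ⟨([], []), Or.inl rfl, (Nat.le_zero.1 hm).symm⟩
  | cons a α ih =>
    rcases Nat.eq_zero_or_pos m with rfl | h0
    · exact ⟨([], a :: α), Or.inl rfl, rfl⟩
    by_cases h : (a : ℕ) ≤ m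
    · obtain ⟨⟨β, γ⟩, hp, hs⟩ := ih (m := m - a) (by rw [size_cons] at hm; omega)
      dsimp only at hs
      refine ⟨(a :: β, γ), ?_, by simp only [size_cons]; omega⟩
      rcases hp with hp | ⟨β', b, c, γ', h1, h2, h3⟩
      · exact Or.inl (by simpa using hp)
      · exact Or.inr ⟨a :: β', b, c, γ', by simpa using h1, h2, by simp [h3]⟩
    · let b : ℕ+ := ⟨m, h0⟩
      let c : ℕ+ := ⟨a - m, by omega⟩
      have hbc : b + c = a := PNat.coe_injective (show m + (a - m) = (a : ℕ) by omega)
      exact ⟨([b], c :: α), Or.inr ⟨[], b, c, α, rfl, rfl, by rw [hbc]; rfl⟩,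
        show size [b] = m by rw [size_cons, size_nil]; rfl⟩

theorem refines_append_iff {β γ β' γ' : Comp} (h : size β = size β') :
    Refines (β ++ γ) (β' ++ γ') ↔ Refines β β' ∧ Refines γ γ' := by
  simp only [refines_iff, size_append, Set.subset_def, mem_cuts_append]
  constructor
  · rintro ⟨hs, hc⟩
    refine ⟨⟨h, fun m hm => ?_⟩, by omega, fun m hm => ?_⟩
    · rcases hc m (Or.inl hm) with h' | ⟨l, hl, h'⟩
      · exact h'
      · have := le_size_of_mem_cuts hm
        have : m = size β := by omega
        rw [this]
        exact size_mem_cuts β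
    · rcases hc _ (Or.inr ⟨m, hm, rfl⟩) with h' | ⟨l, hl, h'⟩
      · have := le_size_of_mem_cuts h'
        have : m = 0 := by omega
        rw [this]
        exact zero_mem_cuts γ
      · have : m = l := by omega
        rwa [this]
  · rintro ⟨⟨-, h1⟩, h2, h3⟩
    refine ⟨by omega, fun m => ?_⟩
    rintro (hm | ⟨l, hl, rfl⟩)
    · exact Or.inl (h1 m hm)
    · exact Or.inr ⟨l, h3 l hl, by omega⟩

theorem refines_append_of_mem_coprodPairs {α γ δ : Comp} {p : Comp × Comp}
    (hp : p ∈ coprodPairs α) (hs : size γ = size p.1) :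
    Refines (γ ++ δ) α ↔ Refines γ p.1 ∧ Refines δ p.2 := by
  rw [← refines_append_iff hs, refines_iff, refines_iff, size_append p.1,
    size_of_mem_coprodPairs hp]
  refine and_congr_right fun _ => ⟨fun h m hm => ?_, fun h m hm => ?_⟩
  · rcases (mem_cuts_of_mem_coprodPairs hp).1 hm with h' | rfl
    · exact h h'
    · exact ⟨γ, δ, rfl, hs.symm⟩
  · exact h ((mem_cuts_of_mem_coprodPairs hp).2 (Or.inl hm))

/-- The product of the coordinates `γ` and `δ` on the two tensor factors. -/
noncomputable def coord₂ (γ δ : Comp) : QSym ⊗[ℚ] QSym →ₗ[ℚ] ℚ :=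
  (LinearMap.mul' ℚ ℚ).comp (TensorProduct.map (coord γ) (coord δ))

@[simp] theorem coord₂_tmul (γ δ : Comp) (f g : QSym) :
    coord₂ γ δ (f ⊗ₜ g) = coord γ f * coord δ g := by
  simp [coord₂]

/-- Dual form of the deconcatenation rule for Δ on monomial functions. On F_α at most one term of
the coproduct contributes, the one whose first factor has size |γ|. -/
theorem coord₂_Δ (γ δ : Comp) (f : QSym) : coord₂ γ δ (Δ f) = coord (γ ++ δ) f := by
  classical
  suffices h : (coord₂ γ δ).comp Δ = coord (γ ++ δ) from LinearMap.congr_fun h f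
  refine basisF.ext fun α => ?_
  have hb : basisF α = F α := by simp [basisF]
  rw [hb, LinearMap.comp_apply, Δ_F, map_sum]
  simp only [coord₂_tmul, coord_F]
  split_ifs with h
  · obtain ⟨p, hp, hs⟩ := exists_mem_coprodPairs (α := α) (m := size γ)
      (by rw [← h.size_eq, size_append]; omega)
    have h' := (refines_append_of_mem_coprodPairs hp hs.symm).1 h
    rw [Finset.sum_eq_single p]
    · simp [h'.1, h'.2]
    · intro q hq hne
      rw [if_neg, zero_mul]
      intro hr
      exact hne (coprodPairs_unique (by simpa using hq) hp (by rw [hs, hr.size_eq]))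
    · intro h''
      exact absurd (by simpa using hp) h''
  · refine Finset.sum_eq_zero fun p hp => ?_
    have hp' : p ∈ coprodPairs α := by simpa using hp
    by_cases h1 : Refines γ p.1
    · rw [if_neg (c := Refines δ p.2), mul_zero]
      exact fun h2 => h ((refines_append_of_mem_coprodPairs hp' h1.size_eq).2 ⟨h1, h2⟩)
    · rw [if_neg h1, zero_mul]

/-! ### Monomial coordinates on the tensor square -/

theorem linearIndependent_M : LinearIndependent ℚ M := by
  rw [linearIndependent_iff]
  intro l hl
  ext α
  have h := congrArg (coord α) hl
  simpa [Finsupp.linearCombination_apply, Finsupp.sum, coord_M] using h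

/-- The monomial quasisymmetric functions as a basis of `QSym`. -/
noncomputable def basisM : Module.Basis Comp ℚ QSym :=
  Module.Basis.mk linearIndependent_M fun f _ => mem_span_M f

theorem basisM_repr (f : QSym) (α : Comp) : basisM.repr f α = coord α f := by
  suffices h : basisM.coord α = coord α from LinearMap.congr_fun h f
  refine basisM.ext fun β => ?_
  have hb : basisM β = M β := by simp [basisM]
  rw [Module.Basis.coord_apply, Module.Basis.repr_self, hb, coord_M, Finsupp.single_apply]
  simp [eq_comm]

theorem tensor_ext {z w : QSym ⊗[ℚ] QSym} (h : ∀ γ δ, coord₂ γ δ z = coord₂ γ δ w) : z = w := by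
  refine (basisM.tensorProduct basisM).ext_elem fun ⟨γ, δ⟩ => ?_
  suffices h' : (basisM.tensorProduct basisM).coord (γ, δ) = coord₂ γ δ by
    have e := fun z => LinearMap.congr_fun h' z
    simp only [Module.Basis.coord_apply] at e
    rw [e, e, h]
  refine TensorProduct.ext' fun f g => ?_
  rw [Module.Basis.coord_apply, Module.Basis.tensorProduct_repr_tmul_apply, basisM_repr,
    basisM_repr, coord₂_tmul]
  simp [mul_comm]

/-! ### Cells and entries -/

theorem part_eq_zero {α : Comp} {r : ℕ} (h : α.length ≤ r) : part α r = 0 := by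
  rw [part, List.getD_eq_default]
  simpa using h

theorem part_eq_getElem {α : Comp} {r : ℕ} (h : r < α.length) : part α r = (α[r] : ℕ) := by
  rw [part, List.getD_eq_getElem _ _ (by simpa using h), List.getElem_map]

theorem part_pos {α : Comp} {r : ℕ} (h : r < α.length) : 0 < part α r := by
  rw [part_eq_getElem h]
  exact (α[r]).pos

theorem lt_length_of_lt_part {α : Comp} {r c : ℕ} (h : c < part α r) : r < α.length := by
  by_contra! h'
  rw [part_eq_zero h'] at h
  omega

theorem mem_skewCells {α β : Comp} {x : (_ : ℕ) × ℕ} :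
    x ∈ skewCells α β ↔ part β x.1 ≤ x.2 ∧ x.2 < part α x.1 := by
  rw [skewCells, Finset.mem_sigma, Finset.mem_range, Finset.mem_Ico]
  exact ⟨fun h => h.2, fun h => ⟨lt_length_of_lt_part h.2, h⟩⟩

section
variable {α β : Comp}

theorem entry_cell (T : Filling α β) (x : skewCells α β) :
    entry T x.1.1 x.1.2 = ((T x : ℕ) : ℕ∞) := by
  rw [entry, dif_pos x.2]

theorem entry_eq_top (T : Filling α β) {r c : ℕ} (h : part α r ≤ c) : entry T r c = ⊤ := by
  rw [entry, dif_neg fun h' => absurd (mem_skewCells.1 h').2 (not_lt.2 h), if_neg (not_lt.2 h)]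

theorem entry_eq_zero (T : Filling α β) {r c : ℕ} (h : c < part α r) (h' : c < part β r) :
    entry T r c = 0 := by
  rw [entry, dif_neg fun h'' => absurd (mem_skewCells.1 h'').1 (not_le.2 h'), if_pos h]

theorem cell_cases (α β : Comp) (r c : ℕ) :
    (∃ x : skewCells α β, x.1 = ⟨r, c⟩) ∨ (c < part α r ∧ c < part β r) ∨ part α r ≤ c := by
  by_cases h1 : c < part α r
  · by_cases h2 : c < part β r
    · exact Or.inr (Or.inl ⟨h1, h2⟩)
    · exact Or.inl ⟨⟨⟨r, c⟩, mem_skewCells.2 ⟨not_lt.1 h2, h1⟩⟩, rfl⟩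
  · exact Or.inr (Or.inr (not_lt.1 h1))

/-- The values 0 and ∞ depend on the position only, so a map preserving strict order on the cells
preserves it on the extended entries. -/
theorem entry_lt_entry {S T : Filling α β} (h : ∀ x y, S x < S y → T x < T y) {r c r' c' : ℕ}
    (h' : entry S r c < entry S r' c') : entry T r c < entry T r' c' := by
  revert h'
  unfold entry
  split_ifs with h1 h2 h3 h4 h5 h6 h7 <;> simp
  exact h _ _

theorem entry_le_entry {S T : Filling α β} (h : ∀ x y, S x < S y → T x < T y) {r c r' c' : ℕ}
    (h' : entry T r c ≤ entry T r' c') : entry S r c ≤ entry S r' c' :=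
  not_lt.1 fun hlt => not_lt.2 h' (entry_lt_entry h hlt)

/-- The triple condition for two cells of the same column, not the first. -/
theorem IsSSYRT.le_of_left_lt {T : Filling α β} (hT : IsSSYRT T) {x y : skewCells α β}
    (hr : x.1.1 < y.1.1) (hc : x.1.2 = y.1.2) (h0 : x.1.2 ≠ 0)
    (hl : ∀ z : skewCells α β, z.1 = ⟨y.1.1, y.1.2 - 1⟩ → T z < T x) : T y ≤ T x := by
  have hy := mem_skewCells.1 y.2
  have hk : x.1.2 - 1 + 1 = x.1.2 := by omega
  have := hT.triple x.1.1 y.1.1 (x.1.2 - 1) hr (lt_length_of_lt_part hy.2) (by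
    rw [hk, entry_cell]
    -- The left neighbour of y is a cell of the skew diagram or a cell of β with entry 0; it cannot
    -- lie outside α because y does not.
    rcases cell_cases α β y.1.1 (x.1.2 - 1) with ⟨z, hz⟩ | ⟨h1, h2⟩ | h
    · have e := entry_cell T z
      rw [hz] at e
      rw [e]
      exact_mod_cast hl z (by rw [hz, hc])
    · rw [entry_eq_zero T h1 h2]
      exact_mod_cast (T x).pos
    · omega)
  rw [hk, entry_cell, hc, entry_cell] at this
  exact_mod_cast this

/-! ### Standardization -/

/-- The order in which the cells with a common entry are read: the columns from right to left,
the first column from bottom to top and the other columns from top to bottom. -/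
def Before (x y : (_ : ℕ) × ℕ) : Prop :=
  y.2 < x.2 ∨ x.2 = y.2 ∧ ((x.2 = 0 ∧ x.1 < y.1) ∨ (x.2 ≠ 0 ∧ y.1 < x.1))

theorem Before.asymm {x y : (_ : ℕ) × ℕ} (h : Before x y) : ¬ Before y x := by
  unfold Before at *
  omega

theorem Before.trans {x y z : (_ : ℕ) × ℕ} (h : Before x y) (h' : Before y z) : Before x z := by
  unfold Before at *
  omega

theorem Before.total {x y : (_ : ℕ) × ℕ} (h : x ≠ y) : Before x y ∨ Before y x := by
  have : x.1 ≠ y.1 ∨ x.2 ≠ y.2 := by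
    by_contra! h'
    exact h (Sigma.ext h'.1 (heq_of_eq h'.2))
  unfold Before
  omega

/-- The strict total order on the cells by which a filling is standardized. -/
def StdLT (S : Filling α β) (x y : skewCells α β) : Prop :=
  S x < S y ∨ S x = S y ∧ Before x.1 y.1

theorem StdLT.asymm {S : Filling α β} {x y : skewCells α β} (h : StdLT S x y) :
    ¬ StdLT S y x := by
  rintro (h' | ⟨h', hb'⟩) <;> rcases h with h | ⟨h, hb⟩
  · exact lt_asymm h h'
  · exact h'.ne h.symm
  · exact h.ne h'.symm
  · exact hb.asymm hb'

theorem StdLT.irrefl {S : Filling α β} (x : skewCells α β) : ¬ StdLT S x x :=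
  fun h => h.asymm h

theorem StdLT.trans {S : Filling α β} {x y z : skewCells α β} (h : StdLT S x y)
    (h' : StdLT S y z) : StdLT S x z := by
  rcases h with h | ⟨h, hb⟩ <;> rcases h' with h' | ⟨h', hb'⟩
  · exact Or.inl (h.trans h')
  · exact Or.inl (h' ▸ h)
  · exact Or.inl (h ▸ h')
  · exact Or.inr ⟨h.trans h', hb.trans hb'⟩

theorem StdLT.total {S : Filling α β} {x y : skewCells α β} (h : x ≠ y) :
    StdLT S x y ∨ StdLT S y x := by
  rcases lt_trichotomy (S x) (S y) with h' | h' | h'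
  · exact Or.inl (Or.inl h')
  · exact (Before.total fun e => h (Subtype.ext e)).imp (fun hb => Or.inr ⟨h', hb⟩)
      fun hb => Or.inr ⟨h'.symm, hb⟩
  · exact Or.inr (Or.inl h')

open Classical in
/-- The standardization of a filling: the position of a cell in the order `StdLT`. -/
noncomputable def std (S : Filling α β) : Filling α β := fun x =>
  ⟨(Finset.univ.filter fun y => y = x ∨ StdLT S y x).card,
    Finset.card_pos.2 ⟨x, by simp⟩⟩

theorem std_lt_of_stdLT {S : Filling α β} {x y : skewCells α β} (h : StdLT S x y) :
    std S x < std S y := by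
  classical
  refine Finset.card_lt_card (Finset.ssubset_iff_of_subset ?_ |>.2 ⟨y, by simp, ?_⟩)
  · intro z hz
    rw [Finset.mem_filter] at hz ⊢
    refine ⟨hz.1, Or.inr ?_⟩
    rcases hz.2 with rfl | h'
    · exact h
    · exact h'.trans h
  · rw [Finset.mem_filter]
    rintro ⟨-, rfl | h'⟩
    · exact StdLT.irrefl _ h
    · exact h.asymm h'

theorem std_lt_iff {S : Filling α β} {x y : skewCells α β} : std S x < std S y ↔ StdLT S x y := by
  refine ⟨fun h => ?_, std_lt_of_stdLT⟩
  rcases eq_or_ne x y with rfl | hne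
  · exact absurd h (lt_irrefl _)
  · exact (StdLT.total hne).resolve_right fun h' => lt_asymm h (std_lt_of_stdLT h')

theorem std_injective (S : Filling α β) : Function.Injective (std S) := by
  intro x y h
  by_contra hne
  rcases StdLT.total (S := S) hne with h' | h'
  · exact (std_lt_of_stdLT h').ne h
  · exact (std_lt_of_stdLT h').ne h.symm

theorem card_cells (α β : Comp) : (Finset.univ : Finset (skewCells α β)).card = skewSize α β := by
  simp [skewSize]

theorem range_of_injective {T : Filling α β} (hi : Function.Injective T)
    (hle : ∀ x, (T x : ℕ) ≤ skewSize α β) :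
    Set.range T = {v : ℕ+ | (v : ℕ) ≤ skewSize α β} := by
  classical
  have : Finset.univ.image (fun x => (T x : ℕ)) = Finset.Icc 1 (skewSize α β) := by
    refine Finset.eq_of_subset_of_card_le ?_ ?_
    · intro v hv
      obtain ⟨x, -, rfl⟩ := Finset.mem_image.1 hv
      exact Finset.mem_Icc.2 ⟨(T x).pos, hle x⟩
    · rw [Finset.card_image_of_injective _ fun x y h => hi (PNat.coe_injective h), card_cells]
      simp
  ext v
  constructor
  · rintro ⟨x, rfl⟩
    exact hle x
  · intro hv
    have : (v : ℕ) ∈ Finset.univ.image (fun x => (T x : ℕ)) := by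
      rw [this]
      exact Finset.mem_Icc.2 ⟨v.pos, hv⟩
    obtain ⟨x, -, hx⟩ := Finset.mem_image.1 this
    exact ⟨x, PNat.coe_injective hx⟩

theorem range_std (S : Filling α β) :
    Set.range (std S) = {v : ℕ+ | (v : ℕ) ≤ skewSize α β} :=
  range_of_injective (std_injective S) fun _ => by
    classical exact (Finset.card_le_card (Finset.filter_subset _ _)).trans (card_cells α β).le

/-- The tie-breaking rule is adapted to the weak inequalities: ties in the first column become
increasing upwards, as the column condition asks, and ties in a later column make the upper entry
smaller, as the conclusion of the triple condition asks. -/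
theorem IsSSYRT.isSYRT_std {S : Filling α β} (hS : IsSSYRT S) : IsSYRT (std S) := by
  refine ⟨⟨?_, ?_, ?_⟩, std_injective S, range_std S⟩
  · exact fun x y h h' => std_lt_of_stdLT (Or.inl (hS.row x y h h'))
  · intro x y hx hy h
    refine (std_lt_of_stdLT ?_).le
    rcases (hS.col x y hx hy h).lt_or_eq with h' | h'
    · exact Or.inl h'
    · exact Or.inr ⟨h', Or.inr ⟨hx.trans hy.symm, Or.inl ⟨hx, h⟩⟩⟩
  · intro i j k hij hj h
    rcases cell_cases α β i (k + 1) with ⟨x, hx⟩ | ⟨h1, h2⟩ | h1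
    · have ex : ∀ T : Filling α β, entry T i (k + 1) = ((T x : ℕ) : ℕ∞) := fun T => by
        rw [← entry_cell, hx]
      have hlt : entry S j k < entry S i (k + 1) := by
        rcases cell_cases α β j k with ⟨y, hy⟩ | ⟨h1, h2⟩ | h1
        · have ey : ∀ T : Filling α β, entry T j k = ((T y : ℕ) : ℕ∞) := fun T => by
            rw [← entry_cell, hy]
          rw [ex, ey] at h ⊢
          have h' : std S y < std S x := by exact_mod_cast h
          rcases std_lt_iff.1 h' with h' | ⟨-, h'⟩
          · exact_mod_cast h'
          · rw [hx, hy, Before] at h'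
            dsimp only at h'
            omega
        · rw [entry_eq_zero S h1 h2, ex]
          exact_mod_cast (S x).pos
        · rw [entry_eq_top _ h1] at h
          exact absurd h not_top_lt
      have hle := hS.triple i j k hij hj hlt
      rcases cell_cases α β j (k + 1) with ⟨y, hy⟩ | ⟨h1, h2⟩ | h1
      · have ey : ∀ T : Filling α β, entry T j (k + 1) = ((T y : ℕ) : ℕ∞) := fun T => by
          rw [← entry_cell, hy]
        rw [ex, ey] at hle ⊢
        have hle' : S y ≤ S x := by exact_mod_cast hle
        have : std S y < std S x := by
          refine std_lt_of_stdLT ?_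
          rcases hle'.lt_or_eq with h' | h'
          · exact Or.inl h'
          · refine Or.inr ⟨h', ?_⟩
            rw [hx, hy, Before]
            dsimp only
            omega
        exact_mod_cast this.le
      · rw [entry_eq_zero _ h1 h2]
        exact zero_le
      · rw [ex, entry_eq_top _ h1] at hle
        exact absurd hle (by simp)
    · rw [entry_eq_zero _ h1 h2] at h
      exact absurd h not_lt_zero
    · rw [entry_eq_top _ h1]
      exact le_top

theorem IsSYRT.le {T : Filling α β} (hT : IsSYRT T) (x : skewCells α β) :
    (T x : ℕ) ≤ skewSize α β := by
  have : T x ∈ Set.range T := ⟨x, rfl⟩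
  rwa [hT.range] at this

theorem IsSYRT.exists_cell {T : Filling α β} (hT : IsSYRT T) {t : ℕ} (h0 : 0 < t)
    (h : t ≤ skewSize α β) : ∃ x, (T x : ℕ) = t := by
  have : (⟨t, h0⟩ : ℕ+) ∈ Set.range T := by
    rw [hT.range]
    exact h
  obtain ⟨x, hx⟩ := this
  exact ⟨x, by rw [hx]; rfl⟩

/-- The number of entries at most `v`. -/
noncomputable def count (S : Filling α β) (v : ℕ) : ℕ :=
  (Finset.univ.filter fun x => (S x : ℕ) ≤ v).card

theorem IsSYRT.count_eq {T : Filling α β} (hT : IsSYRT T) {v : ℕ} (hv : v ≤ skewSize α β) :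
    count T v = v := by
  classical
  have : (Finset.univ.filter fun x => (T x : ℕ) ≤ v).image (fun x => (T x : ℕ)) =
      Finset.Icc 1 v := by
    ext t
    simp only [Finset.mem_image, Finset.mem_filter, Finset.mem_univ, true_and, Finset.mem_Icc]
    constructor
    · rintro ⟨x, hx, rfl⟩
      exact ⟨(T x).pos, hx⟩
    · rintro ⟨h1, h2⟩
      obtain ⟨x, rfl⟩ := hT.exists_cell h1 (h2.trans hv)
      exact ⟨x, h2, rfl⟩
  have h := congrArg Finset.card this
  rw [Finset.card_image_of_injective _ fun x y h => hT.inj (PNat.coe_injective h)] at h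
  simpa [count] using h

theorem mem_revDes {T : Filling α β} {i : ℕ} :
    i ∈ revDes T ↔ ∃ x y : skewCells α β, (T x : ℕ) = i ∧ (T y : ℕ) = i + 1 ∧ x.1.2 < y.1.2 ∧
      i ∈ Finset.Icc 1 (skewSize α β - 1) := by
  simp only [revDes, Finset.mem_filter]
  tauto

theorem IsSYRT.mem_revDes {T : Filling α β} (hT : IsSYRT T) {x y : skewCells α β}
    (h : (T y : ℕ) = T x + 1) : (T x : ℕ) ∈ revDes T ↔ x.1.2 < y.1.2 := by
  rw [YRS.mem_revDes]
  constructor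
  · rintro ⟨x', y', hx, hy, h', -⟩
    obtain rfl := hT.inj (PNat.coe_injective hx)
    obtain rfl := hT.inj (PNat.coe_injective (hy.trans h.symm))
    exact h'
  · intro h'
    refine ⟨x, y, rfl, h, h', Finset.mem_Icc.2 ⟨(T x).pos, ?_⟩⟩
    have := hT.le y
    omega

/-- If i is not a reverse descent, i + 1 lies weakly to the left of i. In a common first column it
must lie above. In a later common column it cannot: its left neighbour, if a cell, would have an
entry less than i + 1 and different from i, hence less than i, and the triple condition would force
i + 1 ≤ i. -/
theorem IsSYRT.before_of_notMem_revDes {T : Filling α β} (hT : IsSYRT T) {x y : skewCells α β}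
    (h : (T y : ℕ) = T x + 1) (hd : (T x : ℕ) ∉ revDes T) : Before x.1 y.1 := by
  rw [hT.mem_revDes h, not_lt] at hd
  have hlt : T x < T y := by
    rw [← PNat.coe_lt_coe]
    omega
  have hne : x.1 ≠ y.1 := fun e => hlt.ne (congrArg T (Subtype.ext e))
  by_contra hb
  have hb' := (Before.total hne).resolve_left hb
  rcases hb' with h1 | ⟨h1, ⟨h0, h2⟩ | ⟨h0, h2⟩⟩
  · omega
  · exact absurd (hT.col y x h0 (by omega) h2) (not_le.2 hlt)
  · refine absurd (hT.le_of_left_lt h2 h1.symm (by omega) fun z hz => ?_) (not_le.2 hlt)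
    have hzy : T z < T y := hT.row z y (by rw [hz]) (by rw [hz]; dsimp only; omega)
    have hzx : T z ≠ T x := fun e => by
      have := hT.inj e
      subst this
      rw [hz] at h2
      exact lt_irrefl _ h2
    rw [← PNat.coe_lt_coe] at hzy ⊢
    have : (T z : ℕ) ≠ T x := fun e => hzx (PNat.coe_injective e)
    omega

theorem IsSYRT.before_of_lt {T : Filling α β} (hT : IsSYRT T) {x y : skewCells α β}
    (h : T x < T y) (hd : ∀ t : ℕ, (T x : ℕ) ≤ t → t < T y → t ∉ revDes T) :
    Before x.1 y.1 := by
  obtain ⟨d, hd'⟩ : ∃ d : ℕ, (T y : ℕ) = T x + 1 + d :=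
    Nat.exists_eq_add_of_le (Nat.succ_le_of_lt h)
  induction d generalizing y with
  | zero => exact hT.before_of_notMem_revDes hd' (hd _ le_rfl h)
  | succ d ih =>
    obtain ⟨z, hz⟩ := hT.exists_cell (t := T x + 1 + d) (by omega)
      (by have := hT.le y; omega)
    have h1 : Before x.1 z.1 := by
      refine ih ?_ (fun t h1 h2 => hd t h1 (by omega)) hz
      rw [← PNat.coe_lt_coe]
      omega
    exact h1.trans (hT.before_of_notMem_revDes (by omega) (hd _ (by omega) (by omega)))

/-! #### The correspondence for a given content -/

/-- `S` is obtained from `T` by replacing the entries in `(P (v - 1), P v]` by `v`. -/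
def Coarsens (P : ℕ → ℕ) (S T : Filling α β) : Prop :=
  ∀ x v, (S x : ℕ) ≤ v ↔ (T x : ℕ) ≤ P v

variable {P : ℕ → ℕ}

theorem Coarsens.unique {S S' T : Filling α β} (h : Coarsens P S T) (h' : Coarsens P S' T) :
    S = S' := by
  funext x
  apply PNat.coe_injective
  exact eq_of_forall_ge_iff fun v => (h x v).trans (h' x v).symm

theorem Coarsens.lt_of_lt {S T : Filling α β} (h : Coarsens P S T) {x y : skewCells α β}
    (hlt : S x < S y) : T x < T y := by
  have h1 := (h x (S x)).1 le_rfl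
  have h2 := mt (h y (S x)).2 (not_le.2 hlt)
  rw [← PNat.coe_lt_coe]
  omega

/-- If x and y receive the same entry in S, no value of P lies in [T x, T y), so there is no reverse
descent in that interval and the cells with these entries come in reading order. -/
theorem Coarsens.stdLT {S T : Filling α β} (h : Coarsens P S T) (hT : IsSYRT T)
    (hd : ∀ i ∈ revDes T, i ∈ Set.range P) {x y : skewCells α β} (hlt : T x < T y) :
    StdLT S x y := by
  rcases lt_trichotomy (S x) (S y) with h' | h' | h'
  · exact Or.inl h'
  · refine Or.inr ⟨h', hT.before_of_lt hlt fun t h1 h2 ht => ?_⟩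
    obtain ⟨v, rfl⟩ := hd t ht
    have := (h y v).1 (h' ▸ (h x v).2 h1)
    omega
  · exact absurd (h.lt_of_lt h') (lt_asymm hlt)

theorem Coarsens.std_eq {S T : Filling α β} (h : Coarsens P S T) (hT : IsSYRT T)
    (hd : ∀ i ∈ revDes T, i ∈ Set.range P) : std S = T := by
  funext x
  apply PNat.coe_injective
  -- In a standard filling an entry equals the number of entries not exceeding it, which has the
  -- same form as the definition of `std`.
  rw [← hT.count_eq (hT.le x)]
  show Finset.card _ = _
  rw [count]
  congr 1
  ext y
  simp only [Finset.mem_filter, Finset.mem_univ, true_and, PNat.coe_le_coe]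
  constructor
  · rintro (rfl | h')
    · exact le_rfl
    · exact not_lt.1 fun hc => h'.asymm (h.stdLT hT hd hc)
  · intro hle
    rcases hle.lt_or_eq with h' | h'
    · exact Or.inr (h.stdLT hT hd h')
    · exact Or.inl (hT.inj h')

theorem Coarsens.isSSYRT {S T : Filling α β} (h : Coarsens P S T) (hT : IsSYRT T)
    (hd : ∀ i ∈ revDes T, i ∈ Set.range P) : IsSSYRT S := by
  refine ⟨fun x y hr hc => ?_, fun x y hx hy hxy => ?_, fun i j k hij hj hlt => ?_⟩
  · rcases h.stdLT hT hd (hT.row x y hr hc) with h' | ⟨-, h'⟩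
    · exact h'
    · unfold Before at h'
      omega
  · exact not_lt.1 fun hc => absurd (h.lt_of_lt hc) (not_lt.2 (hT.col x y hx hy hxy))
  · exact entry_le_entry (fun _ _ => h.lt_of_lt)
      (hT.triple i j k hij hj (entry_lt_entry (fun _ _ => h.lt_of_lt) hlt))

theorem Coarsens.count_eq {S T : Filling α β} (h : Coarsens P S T) (hT : IsSYRT T)
    (hP : ∀ v, P v ≤ skewSize α β) (v : ℕ) : count S v = P v := by
  rw [← hT.count_eq (hP v), count, count]
  congr 1
  ext x
  simp [h x v]

theorem exists_coarsens (hm : Monotone P) (h0 : P 0 = 0) (hn : ∃ v, P v = skewSize α β)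
    {T : Filling α β} (hT : IsSYRT T) : ∃ S, Coarsens P S T := by
  classical
  have hex : ∀ x, ∃ v, (T x : ℕ) ≤ P v := fun x => by
    obtain ⟨v, hv⟩ := hn
    exact ⟨v, hv ▸ hT.le x⟩
  have hpos : ∀ x, 0 < Nat.find (hex x) := fun x => by
    rw [Nat.find_pos, h0]
    exact not_le.2 (T x).pos
  -- The entry of x is the least v with T x ≤ P v; it is positive because P 0 = 0.
  refine ⟨fun x => ⟨Nat.find (hex x), hpos x⟩, fun x v => ?_⟩
  rw [PNat.mk_coe, Nat.find_le_iff]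
  exact ⟨fun ⟨m, h, h'⟩ => h'.trans (hm h), fun h => ⟨v, le_rfl, h⟩⟩

theorem coarsens_std {S : Filling α β} (h : ∀ v, count S v = P v) : Coarsens P S (std S) := by
  classical
  intro x v
  rw [← h, count]
  show _ ↔ Finset.card _ ≤ _
  constructor
  · intro hx
    refine Finset.card_le_card fun y hy => ?_
    simp only [Finset.mem_filter, Finset.mem_univ, true_and] at hy ⊢
    rcases hy with rfl | hy | ⟨hy, -⟩
    · exact hx
    · exact (PNat.coe_le_coe _ _ |>.2 hy.le).trans hx
    · rwa [hy]
  · intro hle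
    by_contra! hx
    refine absurd hle (not_le.2 (Finset.card_lt_card
      (Finset.ssubset_iff_of_subset (fun y hy => ?_) |>.2 ⟨x, by simp, by simpa using hx⟩)))
    simp only [Finset.mem_filter, Finset.mem_univ, true_and] at hy ⊢
    exact Or.inr (Or.inl (PNat.coe_lt_coe _ _ |>.1 (hy.trans_lt hx)))

/-- Ties are numbered from right to left, so a step strictly to the right means that the entry of S
increases there; i is then the number of entries at most S x, which is a value of P. -/
theorem revDes_std_subset {S : Filling α β} (h : ∀ v, count S v = P v) {i : ℕ}
    (hi : i ∈ revDes (std S)) : i ∈ Set.range P := by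
  obtain ⟨x, y, rfl, hy, hlt, -⟩ := mem_revDes.1 hi
  have hS : S x < S y := by
    have : std S x < std S y := by
      rw [← PNat.coe_lt_coe]
      omega
    rcases std_lt_iff.1 this with h' | ⟨-, h'⟩
    · exact h'
    · unfold Before at h'
      omega
  have h1 := (coarsens_std h x (S x)).1 le_rfl
  have h2 := mt (coarsens_std h y (S x)).2 (not_le.2 hS)
  exact ⟨S x, by omega⟩

/-- Standardization and coarsening along P are mutually inverse. Here P v prescribes the number of
entries at most v, that is, the content in cumulative form. -/
theorem card_ssyrt_of_count (hm : Monotone P) (h0 : P 0 = 0) (hn : ∃ v, P v = skewSize α β)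
    (hP : ∀ v, P v ≤ skewSize α β) :
    Nat.card {S : SSYRT α β // ∀ v, count S.1 v = P v} =
      Nat.card {T : SYRT α β // ∀ i ∈ revDes T.1, i ∈ Set.range P} := by
  choose f hf using fun T : SYRT α β => exists_coarsens hm h0 hn T.2
  exact Nat.card_congr
    { toFun := fun S => ⟨⟨std S.1.1, S.1.2.isSYRT_std⟩, fun _ => revDes_std_subset S.2⟩
      invFun := fun T => ⟨⟨f T.1, (hf T.1).isSSYRT T.1.2 T.2⟩, (hf T.1).count_eq T.1.2 hP⟩
      left_inv := fun S => Subtype.ext (Subtype.ext ((hf _).unique (coarsens_std S.2)))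
      right_inv := fun T => Subtype.ext (Subtype.ext ((hf T.1).std_eq T.1.2 T.2)) }

/-! ### The expansion in fundamental quasisymmetric functions -/

theorem size_take_succ (γ : Comp) (v : ℕ) : size (γ.take (v + 1)) = size (γ.take v) + part γ v := by
  by_cases h : v < γ.length
  · rw [List.take_succ_eq_append_getElem h, part_eq_getElem h, size_append, size_cons, size_nil,
      add_zero]
  · rw [part_eq_zero (not_lt.1 h), List.take_of_length_le (by omega),
      List.take_of_length_le (by omega), add_zero]

theorem size_take_le (γ : Comp) (v : ℕ) : size (γ.take v) ≤ size γ := by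
  conv_rhs => rw [← List.take_append_drop v γ, size_append]
  omega

theorem monotone_size_take (γ : Comp) : Monotone fun v => size (γ.take v) :=
  monotone_nat_of_le_succ fun v => by
    rw [size_take_succ]
    omega

theorem range_size_take (γ : Comp) : Set.range (fun v => size (γ.take v)) = cuts γ := by
  ext m
  constructor
  · rintro ⟨v, rfl⟩
    exact ⟨_, _, (List.take_append_drop v γ).symm, rfl⟩
  · rintro ⟨β, δ, rfl, rfl⟩
    exact ⟨β.length, by simp⟩

theorem monoExp_firstVars (γ : Comp) (v : ℕ) :
    monoExp γ (firstVars _) (Nat.succPNat v) = part γ v := by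
  by_cases h : v < γ.length
  · have := monoExp_apply γ (firstVars _) ⟨v, h⟩
    rw [part_eq_getElem h]
    exact this
  · rw [part_eq_zero (not_lt.1 h), monoExp_apply_of_notMem]
    rintro ⟨j, hj⟩
    have : (j : ℕ) = v := Nat.succPNat_injective hj
    omega

theorem weight_apply (S : Filling α β) (v : ℕ+) :
    weight S v = (Finset.univ.filter fun x => S x = v).card := by
  classical
  rw [weight, Finsupp.finsetSum_apply, Finset.card_filter]
  exact Finset.sum_congr rfl fun x _ => by rw [Finsupp.single_apply]

theorem count_zero (S : Filling α β) : count S 0 = 0 := by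
  simp [count]

theorem count_succ (S : Filling α β) (v : ℕ) :
    count S (v + 1) = count S v + weight S (Nat.succPNat v) := by
  classical
  rw [weight_apply, count, count, ← Finset.card_union_of_disjoint]
  · congr 1
    ext x
    simp only [Finset.mem_filter, Finset.mem_univ, true_and, Finset.mem_union,
      ← PNat.coe_inj, Nat.succPNat_coe]
    omega
  · rw [Finset.disjoint_filter]
    intro x _ h1 h2
    rw [h2, Nat.succPNat_coe] at h1
    omega

/-- Cumulative counts carry the same information as the weight. Parts are indexed from 0 and
variables from 1, so part v is the exponent of the variable with index v + 1. -/
theorem weight_eq_iff (S : Filling α β) (γ : Comp) :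
    weight S = monoExp γ (firstVars _) ↔ ∀ v, count S v = size (γ.take v) := by
  constructor
  · intro h v
    induction v with
    | zero => simp [count_zero]
    | succ v ih => rw [count_succ, ih, h, monoExp_firstVars, size_take_succ]
  · intro h
    ext v
    obtain ⟨v, rfl⟩ : ∃ k, v = Nat.succPNat k := ⟨PNat.natPred v, (PNat.succPNat_natPred v).symm⟩
    have := count_succ S v
    rw [h, h, size_take_succ] at this
    rw [monoExp_firstVars]
    omega

theorem coord_ssyrtGenFun (α β γ : Comp) :
    coord γ ⟨ssyrtGenFun α β, ssyrtGenFun_mem α β⟩ =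
      (Nat.card {S : SSYRT α β // ∀ v, count S.1 v = size (γ.take v)} : ℚ) := by
  show ((Nat.card {S : SSYRT α β // weight S.1 = monoExp γ (firstVars _)} : ℕ) : ℚ) = _
  congr 1
  exact Nat.card_congr (Equiv.subtypeEquivRight fun S => weight_eq_iff S.1 γ)

theorem count_of_le {S : Filling α β} {v : ℕ} (h : ∀ x, (S x : ℕ) ≤ v) :
    count S v = skewSize α β := by
  rw [count, Finset.filter_true_of_mem fun x _ => h x, card_cells]

theorem skewSize_eq_of_count {S : Filling α β} {γ : Comp}
    (h : ∀ v, count S v = size (γ.take v)) : skewSize α β = size γ := by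
  have h1 : (weight S).degree = size γ := by rw [(weight_eq_iff S γ).2 h, degree_monoExp]
  rw [← h1, degree_weight]

theorem revDes_subset (T : Filling α β) : revDes T ⊆ Finset.Icc 1 (skewSize α β - 1) :=
  Finset.filter_subset _ _

theorem le_of_mem_revDes {T : Filling α β} {s : ℕ} (h : s ∈ revDes T) : s ≤ skewSize α β := by
  have := Finset.mem_Icc.1 (revDes_subset T h)
  omega

end

/-- Comparison of monomial coordinates: for |γ| = |α//β| the coordinate at γ counts on both sides
the SYRT whose reverse descents are partial sums of γ, and otherwise both sides vanish. -/
theorem ssyrtGenFun_eq_sum_F (α β : Comp) :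
    (⟨ssyrtGenFun α β, ssyrtGenFun_mem α β⟩ : QSym) =
      ∑ T : SYRT α β, F (compOfSet (skewSize α β) (revDes T.1)) := by
  classical
  apply qsym_ext
  intro γ
  rw [coord_ssyrtGenFun, map_sum]
  simp only [coord_F, refines_compOfSet_iff fun s => le_of_mem_revDes]
  by_cases hγ : size γ = skewSize α β
  · rw [card_ssyrt_of_count (monotone_size_take γ) rfl ⟨γ.length, by simp [hγ]⟩
      fun v => hγ ▸ size_take_le γ v]
    simp only [hγ, true_and, range_size_take]
    rw [Finset.sum_boole, Nat.card_eq_fintype_card, Fintype.card_subtype]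
  · simp only [hγ, false_and, if_false, Finset.sum_const_zero]
    have : IsEmpty {S : SSYRT α β // ∀ v, count S.1 v = size (γ.take v)} :=
      ⟨fun S => hγ (skewSize_eq_of_count S.2).symm⟩
    simp

/-! ### Splitting a tableau at a threshold -/

theorem part_nil (r : ℕ) : part [] r = 0 := rfl

theorem part_cons_zero (a : ℕ+) (α : Comp) : part (a :: α) 0 = a := rfl

theorem part_cons_succ (a : ℕ+) (α : Comp) (r : ℕ) : part (a :: α) (r + 1) = part α r := rfl

theorem part_injective : Function.Injective part := by
  intro α β h
  have hl : ∀ γ : Comp, ∀ r, r < γ.length ↔ 0 < part γ r := fun γ r =>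
    ⟨part_pos, lt_length_of_lt_part⟩
  refine List.ext_getElem (eq_of_forall_lt_iff fun r => by rw [hl, hl, h]) fun r h1 h2 => ?_
  apply PNat.coe_injective
  rw [← part_eq_getElem h1, ← part_eq_getElem h2, h]

theorem contained_iff {α β : Comp} : Contained β α ↔ ∀ r, part β r ≤ part α r := by
  constructor
  · rintro ⟨-, h⟩ r
    by_cases hr : r < β.length
    · exact h r hr
    · rw [part_eq_zero (not_lt.1 hr)]
      exact Nat.zero_le _
  · refine fun h => ⟨?_, fun r _ => h r⟩
    by_contra! hl
    have := h α.length
    rw [part_eq_zero le_rfl] at this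
    have := part_pos hl
    omega

theorem size_eq_sum_part (α : Comp) {N : ℕ} (h : α.length ≤ N) :
    size α = ∑ r ∈ Finset.range N, part α r := by
  induction α generalizing N with
  | nil => simp [part_nil]
  | cons a α ih =>
    obtain ⟨N, rfl⟩ : ∃ k, N = k + 1 := ⟨N - 1, by simp at h; omega⟩
    rw [Finset.sum_range_succ', size_cons, ih (by simpa using h)]
    simp only [part_cons_succ, part_cons_zero]
    omega

theorem Contained.size_le {α β : Comp} (h : Contained β α) : size β ≤ size α := by
  rw [size_eq_sum_part α le_rfl, size_eq_sum_part β h.1]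
  exact Finset.sum_le_sum fun r _ => contained_iff.1 h r

theorem finite_contained (α : Comp) : {β | Contained β α}.Finite :=
  (finite_size_le (size α)).subset fun _ h => h.size_le

/-- Row lengths come from a composition as soon as they vanish eventually and no empty row lies
below a nonempty one. -/
theorem exists_part_eq (N : ℕ) (f : ℕ → ℕ) (h0 : ∀ r, N ≤ r → f r = 0)
    (h : ∀ r, 0 < f (r + 1) → 0 < f r) : ∃ β, part β = f := by
  induction N generalizing f with
  | zero => exact ⟨[], funext fun r => (h0 r (Nat.zero_le _)).symm⟩
  | succ N ih =>
    rcases Nat.eq_zero_or_pos (f 0) with hf | hf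
    · refine ⟨[], funext fun r => ?_⟩
      rw [part_nil]
      induction r with
      | zero => exact hf.symm
      | succ r ihr =>
        by_contra hne
        have := h r (Nat.pos_of_ne_zero (Ne.symm hne))
        omega
    · obtain ⟨β, hβ⟩ := ih (fun r => f (r + 1)) (fun r hr => h0 _ (by omega)) fun r => h (r + 1)
      refine ⟨⟨f 0, hf⟩ :: β, funext fun r => ?_⟩
      cases r with
      | zero => rfl
      | succ r => exact congrFun hβ r

section
variable {α β : Comp}

theorem entry_pos {T : Filling α β} {r c : ℕ} (h : part β r ≤ c) : 0 < entry T r c := by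
  rcases cell_cases α β r c with ⟨x, hx⟩ | ⟨h1, h2⟩ | h1
  · have := entry_cell T x
    rw [hx] at this
    rw [this]
    exact_mod_cast (T x).pos
  · omega
  · rw [entry_eq_top _ h1]
    exact ENat.top_pos

theorem filling_ext {S T : Filling α β}
    (h : ∀ r c, part β r ≤ c → c < part α r → entry S r c = entry T r c) : S = T := by
  funext x
  have hx := mem_skewCells.1 x.2
  have := h x.1.1 x.1.2 hx.1 hx.2
  rw [entry_cell, entry_cell] at this
  exact PNat.coe_injective (by exact_mod_cast this)

theorem isSSYRT_iff {T : Filling α β} : IsSSYRT T ↔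
    (∀ r c d, part β r ≤ c → c < d → d < part α r → entry T r c < entry T r d) ∧
    (∀ i j, i < j → part β i = 0 → 0 < part α i → part β j = 0 → 0 < part α j →
      entry T i 0 ≤ entry T j 0) ∧
    ∀ i j k : ℕ, i < j → j < α.length →
      entry T j k < entry T i (k + 1) → entry T j (k + 1) ≤ entry T i (k + 1) := by
  constructor
  · refine fun h => ⟨fun r c d h1 h2 h3 => ?_, fun i j hij h1 h2 h3 h4 => ?_, h.triple⟩
    · have := h.row ⟨⟨r, c⟩, mem_skewCells.2 ⟨h1, h2.trans h3⟩⟩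
        ⟨⟨r, d⟩, mem_skewCells.2 ⟨h1.trans h2.le, h3⟩⟩ rfl h2
      rw [← PNat.coe_lt_coe, ← Nat.cast_lt (α := ℕ∞), ← entry_cell, ← entry_cell] at this
      exact this
    · have := h.col ⟨⟨i, 0⟩, mem_skewCells.2 ⟨h1.le, h2⟩⟩
        ⟨⟨j, 0⟩, mem_skewCells.2 ⟨h3.le, h4⟩⟩ rfl rfl hij
      rw [← PNat.coe_le_coe, ← Nat.cast_le (α := ℕ∞), ← entry_cell, ← entry_cell] at this
      exact this
  · rintro ⟨h1, h2, h3⟩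
    refine ⟨fun x y hr hc => ?_, fun x y hx hy h => ?_, h3⟩
    · have hx := mem_skewCells.1 x.2
      have hy := mem_skewCells.1 y.2
      have := h1 x.1.1 x.1.2 y.1.2 hx.1 hc (hr ▸ hy.2)
      rw [entry_cell, hr, entry_cell] at this
      exact_mod_cast this
    · have hx' := mem_skewCells.1 x.2
      have hy' := mem_skewCells.1 y.2
      have := h2 x.1.1 y.1.1 h (by omega) (by omega) (by omega) (by omega)
      have ex := entry_cell T x
      have ey := entry_cell T y
      rw [hx] at ex
      rw [hy] at ey
      rw [ex, ey] at this
      exact_mod_cast this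

theorem count_eq_card_entry (T : Filling α β) (v : ℕ) :
    count T v = ((skewCells α β).filter fun x => entry T x.1 x.2 ≤ v).card := by
  rw [count]
  refine Finset.card_bij (fun x _ => x.1) ?_ (fun _ _ _ _ h => Subtype.ext h) ?_
  · intro x hx
    rw [Finset.mem_filter] at hx ⊢
    refine ⟨x.2, ?_⟩
    rw [entry_cell]
    exact_mod_cast hx.2
  · intro x hx
    rw [Finset.mem_filter] at hx
    refine ⟨⟨x, hx.1⟩, ?_, rfl⟩
    have := hx.2
    rw [entry_cell T ⟨x, hx.1⟩] at this
    rw [Finset.mem_filter]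
    exact ⟨Finset.mem_univ _, by exact_mod_cast this⟩

/-- The filling `S` of `α` consists of the filling `U` of `β`, with entries at most `m`, and of
the filling `V` of `α // β`, with entries raised by `m`. -/
structure Glued (m : ℕ) (S : Filling α []) (U : Filling β []) (V : Filling α β) : Prop where
  contained : Contained β α
  low : ∀ r c, c < part β r → entry S r c = entry U r c
  low_le : ∀ r c, c < part β r → entry U r c ≤ m
  high : ∀ r c, part β r ≤ c → entry S r c = entry V r c + m

variable {m : ℕ} {S S' : Filling α []} {U U' : Filling β []} {V V' : Filling α β}

theorem Glued.add_lt_add_iff {a b : ℕ∞} (m : ℕ) : a + m < b + m ↔ a < b :=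
  ENat.add_lt_add_iff_right (ENat.natCast_ne_top m)

theorem Glued.add_le_add_iff {a b : ℕ∞} (m : ℕ) : a + m ≤ b + m ↔ a ≤ b :=
  ENat.add_le_add_iff_right (ENat.natCast_ne_top m)

theorem Glued.lt_high (h : Glued m S U V) {r c : ℕ} (hc : part β r ≤ c) :
    (m : ℕ∞) < entry S r c := by
  rw [h.high r c hc]
  have := ENat.add_lt_add_iff_right (k := m) (ENat.natCast_ne_top m) |>.2 (entry_pos (T := V) hc)
  rwa [zero_add] at this

theorem Glued.le_iff (h : Glued m S U V) {r c : ℕ} : entry S r c ≤ m ↔ c < part β r := by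
  constructor
  · intro h'
    by_contra! hc
    exact absurd h' (not_le.2 (h.lt_high hc))
  · intro hc
    rw [h.low r c hc]
    exact h.low_le r c hc

theorem Glued.zero (h : Glued m S U V) {r c : ℕ} (hc : c < part β r) : entry V r c = 0 :=
  entry_eq_zero V (hc.trans_le (contained_iff.1 h.contained r)) hc

theorem Glued.unique_left (h : Glued m S U V) (h' : Glued m S' U V) : S = S' := by
  refine filling_ext fun r c _ _ => ?_
  by_cases hc : c < part β r
  · rw [h.low r c hc, h'.low r c hc]
  · rw [h.high r c (not_lt.1 hc), h'.high r c (not_lt.1 hc)]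

theorem Glued.unique_right (h : Glued m S U V) (h' : Glued m S U' V') : U = U' ∧ V = V' := by
  constructor
  · refine filling_ext fun r c _ hc => ?_
    rw [← h.low r c hc, ← h'.low r c hc]
  · refine filling_ext fun r c hc _ => ?_
    have := h.high r c hc
    rw [h'.high r c hc] at this
    exact le_antisymm ((add_le_add_iff m).1 this.ge) ((add_le_add_iff m).1 this.le)

theorem exists_glued (hc : Contained β α) (hU : ∀ x, (U x : ℕ) ≤ m) (V : Filling α β) :
    ∃ S, Glued m S U V := by
  have hc' := contained_iff.1 hc
  let S : Filling α [] := fun x =>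
    if h : x.1.2 < part β x.1.1 then U ⟨x.1, mem_skewCells.2 ⟨Nat.zero_le _, h⟩⟩
    else ⟨V ⟨x.1, mem_skewCells.2 ⟨not_lt.1 h, (mem_skewCells.1 x.2).2⟩⟩ + m, by simp⟩
  refine ⟨S, hc, fun r c h => ?_, fun r c h => ?_, fun r c h => ?_⟩
  · have h1 := entry_cell S
      ⟨⟨r, c⟩, mem_skewCells.2 ⟨Nat.zero_le _, h.trans_le (hc' r)⟩⟩
    have h2 := entry_cell U ⟨⟨r, c⟩, mem_skewCells.2 ⟨Nat.zero_le _, h⟩⟩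
    dsimp only at h1 h2
    rw [h1, h2]
    congr 2
    exact dif_pos h
  · have h2 := entry_cell U ⟨⟨r, c⟩, mem_skewCells.2 ⟨Nat.zero_le _, h⟩⟩
    dsimp only at h2
    rw [h2]
    exact_mod_cast hU _
  · by_cases hα : c < part α r
    · have h1 := entry_cell S ⟨⟨r, c⟩, mem_skewCells.2 ⟨Nat.zero_le _, hα⟩⟩
      have h2 := entry_cell V ⟨⟨r, c⟩, mem_skewCells.2 ⟨h, hα⟩⟩
      dsimp only at h1 h2
      rw [h1, h2]
      rw [← Nat.cast_add]
      congr 1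
      exact congrArg PNat.val (dif_neg (not_lt.2 h))
    · rw [entry_eq_top _ (not_lt.1 hα), entry_eq_top _ (not_lt.1 hα), top_add]

/-- Rows increase, so the entries at most m are left-justified. The first column increases weakly
upwards, so a row without such entries has none above it either; hence these cells form the diagram
of a composition β. -/
theorem exists_split (hS : IsSSYRT S) (m : ℕ) :
    ∃ (β : Comp) (U : Filling β []) (V : Filling α β), Glued m S U V := by
  classical
  have hrow := (isSSYRT_iff.1 hS).1
  have hcol := (isSSYRT_iff.1 hS).2.1
  have hex : ∀ r, ∃ c, ¬ entry S r c ≤ m := fun r =>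
    ⟨part α r, by rw [entry_eq_top _ le_rfl]; simp⟩
  let f : ℕ → ℕ := fun r => Nat.find (hex r)
  have hle : ∀ r, f r ≤ part α r := fun r =>
    Nat.find_min' _ (by rw [entry_eq_top _ le_rfl]; simp)
  have hlow : ∀ r c, c < f r → entry S r c ≤ m := fun r c h => not_not.1 (Nat.find_min _ h)
  have hhigh : ∀ r c, f r ≤ c → (m : ℕ∞) < entry S r c := fun r c h => by
    have h1 : (m : ℕ∞) < entry S r (f r) := not_le.1 (Nat.find_spec (hex r))
    by_cases hc : c < part α r
    · rcases h.eq_or_lt with rfl | h'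
      · exact h1
      · exact h1.trans (hrow r _ c (Nat.zero_le _) h' hc)
    · rw [entry_eq_top _ (not_lt.1 hc)]
      exact ENat.natCast_lt_top m
  obtain ⟨β, hβ⟩ := exists_part_eq α.length f
    (fun r hr => by have := hle r; rw [part_eq_zero hr] at this; omega) (fun r hr => by
      by_contra h0
      have h1 := hhigh r 0 (by omega)
      have h2 := hlow (r + 1) 0 hr
      have hα : 0 < part α (r + 1) := hr.trans_le (hle _)
      have hα' : 0 < part α r := part_pos ((Nat.lt_succ_self r).trans (lt_length_of_lt_part hα))
      have := hcol r (r + 1) (Nat.lt_succ_self r) rfl hα' rfl hα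
      exact absurd (this.trans h2) (not_le.2 h1))
  clear_value f
  subst hβ
  have hcont : Contained β α := contained_iff.2 hle
  let U : Filling β [] := fun y =>
    S ⟨y.1, mem_skewCells.2 ⟨Nat.zero_le _, (mem_skewCells.1 y.2).2.trans_le (hle _)⟩⟩
  -- The entries of S outside β exceed m, so the default value of `Nat.toPNat'` at 0 is never taken.
  let V : Filling α β := fun y =>
    Nat.toPNat' ((S ⟨y.1, mem_skewCells.2 ⟨Nat.zero_le _, (mem_skewCells.1 y.2).2⟩⟩ : ℕ) - m)
  have hUS : ∀ r c, c < part β r → entry S r c = entry U r c := fun r c h => by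
    have h1 := entry_cell S
      ⟨⟨r, c⟩, mem_skewCells.2 ⟨Nat.zero_le _, h.trans_le (hle r)⟩⟩
    have h2 := entry_cell U ⟨⟨r, c⟩, mem_skewCells.2 ⟨Nat.zero_le _, h⟩⟩
    exact h1.trans h2.symm
  refine ⟨β, U, V, hcont, hUS, fun r c h => hUS r c h ▸ hlow r c h, fun r c h => ?_⟩
  by_cases hα : c < part α r
  · have h1 := entry_cell S ⟨⟨r, c⟩, mem_skewCells.2 ⟨Nat.zero_le _, hα⟩⟩
    have h2 := entry_cell V ⟨⟨r, c⟩, mem_skewCells.2 ⟨h, hα⟩⟩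
    have h3 := hhigh r c h
    dsimp only at h1 h2
    rw [h1] at h3
    have h3' := Nat.cast_lt.1 h3
    have hV : (V ⟨⟨r, c⟩, mem_skewCells.2 ⟨h, hα⟩⟩ : ℕ) =
        S ⟨⟨r, c⟩, mem_skewCells.2 ⟨Nat.zero_le _, hα⟩⟩ - m :=
      (Nat.toPNat'_coe _).trans (if_pos (Nat.sub_pos_of_lt h3'))
    rw [h1, h2, ← Nat.cast_add, hV, Nat.sub_add_cancel h3'.le]
  · rw [entry_eq_top _ (not_lt.1 hα), entry_eq_top _ (not_lt.1 hα), top_add]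

/-- The danger is a cell (j, k + 1) outside β, with entry ∞ in U. When (i, k + 1) lies in β and the
hypothesis of the triple condition holds, the triple condition of S bounds the entry at (j, k + 1)
by m, which puts that cell in β. -/
theorem Glued.isSSYRT_lower (h : Glued m S U V) (hS : IsSSYRT S) : IsSSYRT U := by
  obtain ⟨hrow, hcol, htri⟩ := isSSYRT_iff.1 hS
  have hc := contained_iff.1 h.contained
  refine isSSYRT_iff.2 ⟨fun r c d h1 h2 h3 => ?_, fun i j hij h1 h2 h3 h4 => ?_,
    fun i j k hij hj hlt => ?_⟩
  · rw [← h.low r c (h2.trans h3), ← h.low r d h3]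
    exact hrow r c d h1 h2 (h3.trans_le (hc r))
  · rw [← h.low i 0 h2, ← h.low j 0 h4]
    exact hcol i j hij h1 (h2.trans_le (hc i)) h3 (h4.trans_le (hc j))
  · by_cases hi : k + 1 < part β i
    · by_cases hjk : k < part β j
      · rw [← h.low j k hjk, ← h.low i _ hi] at hlt
        have hle := htri i j k hij (hj.trans_le h.contained.1) hlt
        have hj' : k + 1 < part β j := h.le_iff.1 (hle.trans (h.le_iff.2 hi))
        rwa [← h.low j _ hj', ← h.low i _ hi]
      · rw [entry_eq_top U (not_lt.1 hjk)] at hlt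
        exact absurd hlt not_top_lt
    · rw [entry_eq_top U (not_lt.1 hi)]
      exact le_top

/-- Cells of β have entry 0 in V and entry at most m in S; either way they are below every entry
outside β, so the triple condition of S transfers. -/
theorem Glued.isSSYRT_upper (h : Glued m S U V) (hS : IsSSYRT S) : IsSSYRT V := by
  obtain ⟨hrow, hcol, htri⟩ := isSSYRT_iff.1 hS
  refine isSSYRT_iff.2 ⟨fun r c d h1 h2 h3 => ?_, fun i j hij h1 h2 h3 h4 => ?_,
    fun i j k hij hj hlt => ?_⟩
  · rw [← add_lt_add_iff m, ← h.high r c h1, ← h.high r d (h1.trans h2.le)]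
    exact hrow r c d (Nat.zero_le _) h2 h3
  · rw [← add_le_add_iff m, ← h.high i 0 h1.le, ← h.high j 0 h3.le]
    exact hcol i j hij rfl h2 rfl h4
  · by_cases hj' : k + 1 < part β j
    · rw [h.zero hj']
      exact zero_le
    have hi : part β i ≤ k + 1 := by
      by_contra! hi
      rw [h.zero hi] at hlt
      exact absurd hlt not_lt_zero
    rw [← add_le_add_iff m, ← h.high _ _ hi, ← h.high _ _ (not_lt.1 hj')]
    refine htri i j k hij hj ?_
    by_cases hjk : k < part β j
    · exact (h.le_iff.2 hjk).trans_lt (h.lt_high hi)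
    · rw [h.high _ _ hi, h.high _ _ (not_lt.1 hjk)]
      exact (add_lt_add_iff m).2 hlt

/-- The triple condition splits according to the cell (i, k + 1). If it lies in β, the comparison
takes place in U, whose ∞ outside β forces (j, k + 1) into β. Otherwise either (j, k + 1) has a
small entry or the condition for V applies. -/
theorem Glued.isSSYRT (h : Glued m S U V) (hU : IsSSYRT U) (hV : IsSSYRT V) : IsSSYRT S := by
  obtain ⟨urow, ucol, utri⟩ := isSSYRT_iff.1 hU
  obtain ⟨vrow, vcol, vtri⟩ := isSSYRT_iff.1 hV
  refine isSSYRT_iff.2 ⟨fun r c d h1 h2 h3 => ?_, fun i j hij h1 h2 h3 h4 => ?_,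
    fun i j k hij hj hlt => ?_⟩
  · by_cases hd : d < part β r
    · rw [h.low r c (h2.trans hd), h.low r d hd]
      exact urow r c d h1 h2 hd
    · by_cases hc : c < part β r
      · exact (h.le_iff.2 hc).trans_lt (h.lt_high (not_lt.1 hd))
      · rw [h.high _ _ (not_lt.1 hc), h.high _ _ (not_lt.1 hd)]
        exact (add_lt_add_iff m).2 (vrow r c d (not_lt.1 hc) h2 h3)
  · by_cases hj : 0 < part β j
    · have hi : 0 < part β i := part_pos (hij.trans (lt_length_of_lt_part hj))
      rw [h.low i 0 hi, h.low j 0 hj]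
      exact ucol i j hij rfl hi rfl hj
    · by_cases hi : 0 < part β i
      · exact ((h.le_iff.2 hi).trans_lt (h.lt_high (not_lt.1 hj))).le
      · rw [h.high _ _ (not_lt.1 hi), h.high _ _ (not_lt.1 hj)]
        exact (add_le_add_iff m).2 (vcol i j hij (by omega) h2 (by omega) h4)
  · by_cases hi : k + 1 < part β i
    · have hjk : k < part β j := h.le_iff.1 (hlt.le.trans (h.le_iff.2 hi))
      have hlt' := hlt
      rw [h.low _ _ hi, h.low _ _ hjk] at hlt'
      have hle := utri i j k hij (lt_length_of_lt_part hjk) hlt'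
      have hj' : k + 1 < part β j := by
        by_contra! hj'
        rw [entry_eq_top U hj'] at hle
        exact absurd (hle.trans (h.low_le _ _ hi)) (by simp)
      rwa [h.low _ _ hi, h.low _ _ hj']
    · have hi' := not_lt.1 hi
      by_cases hj' : k + 1 < part β j
      · exact ((h.le_iff.2 hj').trans_lt (h.lt_high hi')).le
      · rw [h.high _ _ hi', h.high _ _ (not_lt.1 hj')]
        refine (add_le_add_iff m).2 (vtri i j k hij hj ?_)
        by_cases hjk : k < part β j
        · rw [h.zero hjk]
          exact entry_pos hi'
        · rw [h.high _ _ hi', h.high _ _ (not_lt.1 hjk)] at hlt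
          exact (add_lt_add_iff m).1 hlt

/-! ### The content of a glued tableau -/

theorem Glued.count_eq (h : Glued m S U V) (w : ℕ) :
    count S w = count U w + ((skewCells α β).filter fun x => entry V x.1 x.2 + m ≤ w).card := by
  classical
  rw [count_eq_card_entry, count_eq_card_entry, ← Finset.card_union_of_disjoint]
  · congr 1
    ext x
    have hc := contained_iff.1 h.contained x.1
    simp only [Finset.mem_union, Finset.mem_filter, mem_skewCells, part_nil, Nat.zero_le,
      true_and]
    by_cases hx : x.2 < part β x.1
    · rw [h.low _ _ hx]
      have h1 : x.2 < part α x.1 := by omega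
      have h2 : ¬ part β x.1 ≤ x.2 := by omega
      simp [hx, h1, h2]
    · rw [h.high _ _ (not_lt.1 hx)]
      simp [hx, not_lt.1 hx]
  · rw [Finset.disjoint_left]
    intro x hx hx'
    rw [Finset.mem_filter, mem_skewCells] at hx hx'
    omega

theorem Glued.count_of_le (h : Glued m S U V) {w : ℕ} (hw : w ≤ m) :
    count S w = count U w := by
  rw [h.count_eq, Finset.card_eq_zero.2, add_zero]
  refine Finset.filter_eq_empty_iff.2 fun x hx hle => ?_
  have hβ := (mem_skewCells.1 hx).1
  rw [← h.high _ _ hβ] at hle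
  exact absurd (hle.trans (Nat.cast_le.2 hw)) (not_le.2 (h.lt_high hβ))

theorem Glued.count_add (h : Glued m S U V) (w : ℕ) :
    count S (w + m) = count U (w + m) + count V w := by
  rw [h.count_eq, count_eq_card_entry V]
  simp only [Nat.cast_add, add_le_add_iff]

theorem Glued.coe_le (h : Glued m S U V) (x : skewCells β []) : (U x : ℕ) ≤ m := by
  have := h.low_le x.1.1 x.1.2 (mem_skewCells.1 x.2).2
  rw [entry_cell] at this
  exact_mod_cast this

theorem coe_le_of_count {T : Filling α β} {v : ℕ} (h : count T v = skewSize α β)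
    (x : skewCells α β) : (T x : ℕ) ≤ v := by
  rw [count, ← card_cells, Finset.card_filter_eq_iff] at h
  exact h x (Finset.mem_univ x)

/-- With the threshold ℓ(γ), the counts up to ℓ(γ) see only U, and beyond it they see all of U plus
the counts of V shifted by ℓ(γ). -/
theorem Glued.count_iff {γ δ : Comp} (h : Glued γ.length S U V) :
    (∀ v, count S v = size ((γ ++ δ).take v)) ↔
      (∀ v, count U v = size (γ.take v)) ∧ ∀ v, count V v = size (δ.take v) := by
  have htop : ∀ v, γ.length ≤ v → count U v = count U γ.length := fun v hv => by
    rw [YRS.count_of_le h.coe_le, YRS.count_of_le fun x => (h.coe_le x).trans hv]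
  simp only [List.take_append, size_append]
  constructor
  · intro hS
    have hU : ∀ v, count U v = size (γ.take v) := fun v => by
      rcases le_total v γ.length with hv | hv
      · rw [← h.count_of_le hv, hS, Nat.sub_eq_zero_of_le hv]
        simp
      · rw [htop v hv, ← h.count_of_le le_rfl, hS, List.take_of_length_le hv]
        simp
    refine ⟨hU, fun v => ?_⟩
    have := h.count_add v
    rw [hS, hU, Nat.add_sub_cancel] at this
    omega
  · rintro ⟨hU, hV⟩ v
    rcases le_total v γ.length with hv | hv
    · rw [h.count_of_le hv, hU, Nat.sub_eq_zero_of_le hv]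
      simp
    · obtain ⟨w, rfl⟩ := Nat.exists_eq_add_of_le' hv
      rw [h.count_add, hU, hV, Nat.add_sub_cancel]

end

/-- Cutting at ℓ(γ) and gluing are inverse to each other. This is the M_γ ⊗ M_δ coordinate of the
coproduct formula for R_α. -/
theorem card_ssyrt_append (α γ δ : Comp) :
    Nat.card {S : SSYRT α [] // ∀ v, count S.1 v = size ((γ ++ δ).take v)} =
      ∑ β ∈ (finite_contained α).toFinset,
        Nat.card {U : SSYRT β [] // ∀ v, count U.1 v = size (γ.take v)} *
        Nat.card {V : SSYRT α β // ∀ v, count V.1 v = size (δ.take v)} := by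
  classical
  have hfin : ∀ (α β γ : Comp), Finite {V : SSYRT α β // ∀ v, count V.1 v = size (γ.take v)} :=
    fun α β γ => Finite.of_equiv {V : SSYRT α β // weight V.1 = monoExp γ (firstVars _)}
      (Equiv.subtypeEquivRight fun V => weight_eq_iff V.1 γ)
  rw [← Finset.sum_coe_sort]
  simp only [← Nat.card_prod]
  rw [← Nat.card_sigma]
  have hex : ∀ z : Σ β : (finite_contained α).toFinset,
      {U : SSYRT β.1 [] // ∀ v, count U.1 v = size (γ.take v)} ×
        {V : SSYRT α β.1 // ∀ v, count V.1 v = size (δ.take v)},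
      ∃ S, Glued γ.length S z.2.1.1.1 z.2.2.1.1 := fun z =>
    exists_glued ((finite_contained α).mem_toFinset.1 z.1.2) (coe_le_of_count (by
      rw [z.2.1.2, skewSize_eq_of_count z.2.1.2, List.take_length])) _
  choose f hf using hex
  symm
  refine Nat.card_eq_of_bijective (fun z => ⟨⟨f z, (hf z).isSSYRT z.2.1.1.2 z.2.2.1.2⟩,
    (hf z).count_iff.2 ⟨z.2.1.2, z.2.2.2⟩⟩) ⟨?_, ?_⟩
  · intro z z' h
    have hS : f z = f z' := congrArg (fun S => S.1.1) h
    have h1 := hf z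
    have h2 := hf z'
    rw [← hS] at h2
    obtain ⟨⟨β, hβ⟩, ⟨U, hU⟩, ⟨V, hV⟩⟩ := z
    obtain ⟨⟨β', hβ'⟩, ⟨U', hU'⟩, ⟨V', hV'⟩⟩ := z'
    -- The inner shape is recovered from the glued tableau as the set of cells with entry at most
    -- ℓ(γ).
    have hb : β = β' := part_injective <| funext fun r =>
      eq_of_forall_lt_iff fun c => h1.le_iff.symm.trans h2.le_iff
    subst hb
    obtain ⟨e1, e2⟩ := h1.unique_right h2
    have e1' : U = U' := Subtype.ext e1
    have e2' : V = V' := Subtype.ext e2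
    subst e1' e2'
    rfl
  · rintro ⟨S, hS⟩
    obtain ⟨β, U, V, h⟩ := exists_split S.2 γ.length
    have hc := h.count_iff.1 hS
    let z : Σ β : (finite_contained α).toFinset,
      {U : SSYRT β.1 [] // ∀ v, count U.1 v = size (γ.take v)} ×
        {V : SSYRT α β.1 // ∀ v, count V.1 v = size (δ.take v)} :=
      ⟨⟨β, by simpa using h.contained⟩, ⟨⟨U, h.isSSYRT_lower S.2⟩, hc.1⟩,
        ⟨⟨V, h.isSSYRT_upper S.2⟩, hc.2⟩⟩
    exact ⟨z, Subtype.ext (Subtype.ext ((hf z).unique_left h))⟩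

/-- The generating function of the SSYRT of shape `α // β` as an element of `QSym`. -/
noncomputable def skewR (α β : Comp) : QSym := ⟨ssyrtGenFun α β, ssyrtGenFun_mem α β⟩

theorem Δ_R (α : Comp) :
    Δ (R α) = ∑ β ∈ (finite_contained α).toFinset, R β ⊗ₜ[ℚ] skewR α β := by
  refine tensor_ext fun γ δ => ?_
  rw [coord₂_Δ, map_sum]
  simp only [coord₂_tmul, R, skewR, coord_ssyrtGenFun, card_ssyrt_append]
  push_cast
  rfl

/-! ### Linear independence of the functions `R α` -/

theorem skewSize_nil (α : Comp) : skewSize α [] = size α := by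
  rw [skewSize, skewCells, Finset.card_sigma, size_eq_sum_part α le_rfl]
  simp [part_nil]

theorem mem_skewCells_nil {α : Comp} {x : (_ : ℕ) × ℕ} :
    x ∈ skewCells α [] ↔ x.2 < part α x.1 := by
  rw [mem_skewCells, part_nil]
  simp

/-- The tableau of shape `α` with the entries `1, 2, …` in the rows from bottom to top. -/
def rowFilling (α : Comp) : Filling α [] := fun x =>
  Nat.succPNat (size (α.take x.1.1) + x.1.2)

theorem rowFilling_apply {α : Comp} (x : skewCells α []) :
    (rowFilling α x : ℕ) = size (α.take x.1.1) + x.1.2 + 1 := rfl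

theorem rowFilling_le {α : Comp} (x : skewCells α []) :
    (rowFilling α x : ℕ) ≤ size (α.take (x.1.1 + 1)) := by
  have := mem_skewCells_nil.1 x.2
  rw [rowFilling_apply, size_take_succ]
  omega

theorem rowFilling_lt_of_row_lt {α : Comp} {x y : skewCells α []} (h : x.1.1 < y.1.1) :
    (rowFilling α x : ℕ) < rowFilling α y := by
  have h1 := rowFilling_le x
  have h2 : size (α.take (x.1.1 + 1)) ≤ size (α.take y.1.1) := monotone_size_take α h
  rw [rowFilling_apply y]
  omega

theorem rowFilling_injective (α : Comp) : Function.Injective (rowFilling α) := by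
  intro x y h
  have hr : x.1.1 = y.1.1 := by
    rcases lt_trichotomy x.1.1 y.1.1 with h' | h' | h'
    · exact absurd (rowFilling_lt_of_row_lt h') (by rw [h]; exact lt_irrefl _)
    · exact h'
    · exact absurd (rowFilling_lt_of_row_lt h') (by rw [h]; exact lt_irrefl _)
  have hc : (rowFilling α x : ℕ) = rowFilling α y := by rw [h]
  rw [rowFilling_apply, rowFilling_apply, hr] at hc
  exact Subtype.ext (Sigma.ext hr (heq_of_eq (by omega)))

theorem isSYRT_rowFilling (α : Comp) : IsSYRT (rowFilling α) := by
  refine ⟨⟨fun x y hr hc => ?_, fun x y hx hy h => ?_, fun i j k hij hj h => ?_⟩,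
    rowFilling_injective α, range_of_injective (rowFilling_injective α) fun x => ?_⟩
  · rw [← PNat.coe_lt_coe, rowFilling_apply, rowFilling_apply, hr]
    omega
  · rw [← PNat.coe_le_coe]
    exact (rowFilling_lt_of_row_lt h).le
  · rcases cell_cases α [] i (k + 1) with ⟨x, hx⟩ | ⟨h1, h2⟩ | h1
    · rcases cell_cases α [] j k with ⟨y, hy⟩ | ⟨h1, h2⟩ | h1
      · have ex := entry_cell (rowFilling α) x
        have ey := entry_cell (rowFilling α) y
        have hlt := rowFilling_lt_of_row_lt (x := x) (y := y) (by rw [hx, hy]; exact hij)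
        rw [hx] at ex
        rw [hy] at ey
        rw [ex, ey, Nat.cast_lt] at h
        omega
      · exact absurd h2 (Nat.not_lt_zero _)
      · rw [entry_eq_top _ h1] at h
        exact absurd h not_top_lt
    · exact absurd h2 (Nat.not_lt_zero _)
    · rw [entry_eq_top _ h1]
      exact le_top
  · rw [skewSize_nil]
    exact (rowFilling_le x).trans (size_take_le _ _)

/-- The sum of the columns of the cells. -/
def colSum (α : Comp) : ℕ := ∑ x : skewCells α [], x.1.2

section
variable {α β : Comp} {T : Filling β []} {e : skewCells α [] ≃ skewCells β []}

/-- Each step to the right in a row of α is a reverse descent of the row filling, hence of T, so the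
column in T moves strictly right at that step too. -/
theorem col_le_of_revDes_eq (hT : IsSYRT T) (hd : revDes T = revDes (rowFilling α))
    (he : ∀ x, T (e x) = rowFilling α x) (c : ℕ) (x : skewCells α []) (hx : x.1.2 = c) :
    c ≤ (e x).1.2 := by
  induction c generalizing x with
  | zero => exact Nat.zero_le _
  | succ c ih =>
    have hxm := mem_skewCells_nil.1 x.2
    let y : skewCells α [] := ⟨⟨x.1.1, c⟩, mem_skewCells_nil.2 (by dsimp only; omega)⟩
    have hxy : (rowFilling α x : ℕ) = rowFilling α y + 1 := by
      rw [rowFilling_apply, rowFilling_apply, hx]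
      rfl
    have h1 : (rowFilling α y : ℕ) ∈ revDes (rowFilling α) :=
      ((isSYRT_rowFilling α).mem_revDes hxy).2 (by rw [hx]; exact Nat.lt_succ_self c)
    rw [← hd, ← he, hT.mem_revDes (y := e x) (by rw [he, he, hxy])] at h1
    have := ih y rfl
    omega

/-- Once the columns agree, T is forced to be the row filling: by induction on the entry, all
smaller entries already sit in the same cells, and the column and triple conditions leave one row
for the next. -/
theorem row_eq_of_col_eq (hT : IsSYRT T) (he : ∀ x, T (e x) = rowFilling α x)
    (hc : ∀ x, (e x).1.2 = x.1.2) (n : ℕ) (x : skewCells α []) (hx : (rowFilling α x : ℕ) = n) :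
    (e x).1 = x.1 := by
  induction n using Nat.strong_induction_on generalizing x with
  | _ n ih =>
  have ih' : ∀ y, rowFilling α y < rowFilling α x → (e y).1 = y.1 := fun y hy =>
    ih _ (by rw [← hx]; exact hy) y rfl
  have small : ∀ z : skewCells β [], T z < T (e x) →
      ∃ y : skewCells α [], z = e y ∧ y.1 = z.1 ∧ y.1.1 ≤ x.1.1 := fun z hz => by
    obtain ⟨y, rfl⟩ := e.surjective z
    rw [he, he] at hz
    refine ⟨y, rfl, (ih' y hz).symm, ?_⟩
    by_contra! h
    exact absurd (rowFilling_lt_of_row_lt h) (not_lt.2 (PNat.coe_le_coe _ _ |>.2 hz.le))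
  -- If the position of x is a cell of β with entry at most T (e x), equality must hold: a smaller
  -- entry would already occupy that position in the row filling, where x sits.
  have key : ∀ w : skewCells β [], w.1 = x.1 → T w ≤ T (e x) → (e x).1 = x.1 := by
    intro w hw hle
    rcases hle.lt_or_eq with h | h
    · obtain ⟨y, rfl, hy, -⟩ := small w h
      have : y = x := Subtype.ext (hy.trans hw)
      rw [← this, hw, this]
    · rw [← hT.inj h, hw]
  have hα := mem_skewCells_nil.1 x.2
  have hβ := mem_skewCells_nil.1 (e x).2
  rw [hc x] at hβ
  have hext : ∀ {y z : (_ : ℕ) × ℕ}, y.1 = z.1 → y.2 = z.2 → y = z := fun h h' =>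
    Sigma.ext h (heq_of_eq h')
  obtain ⟨k, hk⟩ | h0 : (∃ k, x.1.2 = k + 1) ∨ x.1.2 = 0 := by
    rcases Nat.eq_zero_or_pos x.1.2 with h | h
    · exact Or.inr h
    · exact Or.inl ⟨x.1.2 - 1, by omega⟩
  · let z : skewCells β [] := ⟨⟨(e x).1.1, k⟩, mem_skewCells_nil.2 (by dsimp only; omega)⟩
    have hz : T z < T (e x) := hT.row z (e x) rfl (by rw [hc x, hk]; exact Nat.lt_succ_self k)
    obtain ⟨y, -, hy, hyr⟩ := small z hz
    rw [hy] at hyr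
    -- The left neighbour of `e x` is already placed, so the row of `e x` is at most that of x. If
    -- it were lower, the triple condition, applied with the left neighbour of x, would put an entry
    -- at most T (e x) at the position of x.
    rcases (show (e x).1.1 ≤ x.1.1 from hyr).lt_or_eq with hr | hr
    · let y : skewCells α [] := ⟨⟨x.1.1, k⟩, mem_skewCells_nil.2 (by dsimp only; omega)⟩
      have hy : rowFilling α y < rowFilling α x :=
        (isSYRT_rowFilling α).row y x rfl (by rw [hk]; exact Nat.lt_succ_self k)
      have hey := ih' y hy
      have hm := mem_skewCells_nil.1 (e y).2
      rw [hey] at hm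
      have e1 := entry_cell T (e y)
      have e2 := entry_cell T (e x)
      rw [hey] at e1
      rw [hc x, hk] at e2
      have h3 := hT.triple (e x).1.1 x.1.1 k hr (lt_length_of_lt_part hm) (by
        rw [e2, show entry T x.1.1 k = _ from e1, he, he]
        exact_mod_cast hy)
      rw [e2] at h3
      rcases cell_cases β [] x.1.1 (k + 1) with ⟨w, hw⟩ | ⟨-, h2⟩ | h1
      · have e3 := entry_cell T w
        rw [hw] at e3
        rw [show entry T x.1.1 (k + 1) = _ from e3] at h3
        exact key w (hw.trans (hext rfl hk.symm)) (by exact_mod_cast h3)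
      · exact absurd h2 (Nat.not_lt_zero _)
      · rw [entry_eq_top _ h1] at h3
        exact absurd h3 (by simp)
    · exact hext hr (hc x)
  · rcases lt_trichotomy (e x).1.1 x.1.1 with hr | hr | hr
    -- In a lower row, the first cell is already occupied by the smaller entry which the row filling
    -- puts there.
    · let y : skewCells α [] := ⟨⟨(e x).1.1, 0⟩,
        mem_skewCells_nil.2 (part_pos (hr.trans (lt_length_of_lt_part hα)))⟩
      have hy : (e y).1 = y.1 := ih' y (PNat.coe_lt_coe _ _ |>.1 (rowFilling_lt_of_row_lt hr))
      have : e y = e x := Subtype.ext (hy.trans (hext rfl ((hc x).trans h0).symm))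
      rw [e.injective this] at hy
      exact hy
    · exact hext hr (hc x)
    · let w : skewCells β [] := ⟨⟨x.1.1, 0⟩,
        mem_skewCells_nil.2 (part_pos (hr.trans (lt_length_of_lt_part hβ)))⟩
      exact key w (hext rfl h0.symm) (hT.col w (e x) rfl ((hc x).trans h0) hr)

end

/-- Matching cells with equal entries moves no cell to the left, so the bound on the column sums
makes every column equal, and then every cell. -/
theorem eq_of_revDes_eq {α β : Comp} {T : Filling β []} (hT : IsSYRT T)
    (hs : size β = size α) (hd : revDes T = revDes (rowFilling α)) (hle : colSum β ≤ colSum α) :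
    β = α := by
  have hr : Set.range T = Set.range (rowFilling α) := by
    rw [hT.range, (isSYRT_rowFilling α).range, skewSize_nil, skewSize_nil, hs]
  let e : skewCells α [] ≃ skewCells β [] :=
    (Equiv.ofInjective _ (rowFilling_injective α)).trans
      ((Equiv.setCongr hr.symm).trans (Equiv.ofInjective _ hT.inj).symm)
  have he : ∀ x, T (e x) = rowFilling α x := fun x =>
    Equiv.apply_ofInjective_symm hT.inj _
  have h1 : ∀ x, x.1.2 ≤ (e x).1.2 := fun x => col_le_of_revDes_eq hT hd he _ x rfl
  have h2 : colSum β = ∑ x, (e x).1.2 := (e.sum_comp fun y => y.1.2).symm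
  have h3 : ∑ x : skewCells α [], x.1.2 = ∑ x, (e x).1.2 :=
    le_antisymm (Finset.sum_le_sum fun x _ => h1 x) (h2 ▸ hle)
  have hc : ∀ x, (e x).1.2 = x.1.2 := fun x =>
    ((Finset.sum_eq_sum_iff_of_le fun x _ => h1 x).1 h3 x (Finset.mem_univ x)).symm
  have hcell : ∀ x, (e x).1 = x.1 := fun x => row_eq_of_col_eq hT he hc _ x rfl
  refine part_injective (funext fun r => eq_of_forall_lt_iff fun c => ?_)
  constructor
  · intro h
    obtain ⟨x, hx⟩ := e.surjective ⟨⟨r, c⟩, mem_skewCells_nil.2 h⟩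
    have h4 := mem_skewCells_nil.1 x.2
    rw [← hcell, hx] at h4
    exact h4
  · intro h
    have h4 := mem_skewCells_nil.1 (e ⟨⟨r, c⟩, mem_skewCells_nil.2 h⟩).2
    rw [hcell] at h4
    exact h4

theorem R_eq_sum_F (α : Comp) :
    R α = ∑ T : SYRT α [], F (compOfSet (skewSize α []) (revDes T.1)) :=
  ssyrtGenFun_eq_sum_F α []

open Classical in
theorem basisF_repr_R (α δ : Comp) : basisF.repr (R α) δ =
    ((Finset.univ.filter fun T : SYRT α [] =>
      compOfSet (skewSize α []) (revDes T.1) = δ).card : ℚ) := by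
  have hb : ∀ γ, F γ = basisF γ := fun γ => by simp [basisF]
  rw [R_eq_sum_F, map_sum, Finsupp.finsetSum_apply, Finset.card_filter]
  push_cast
  refine Finset.sum_congr rfl fun T _ => ?_
  rw [hb, Module.Basis.repr_self, Finsupp.single_apply]

/-- Among the indices of a vanishing combination take α of maximal column sum and read off the
coefficient of the F indexed by the descents of the row filling of α. By triangularity only R_α
contributes, with a positive multiplicity. -/
theorem linearIndependent_R : LinearIndependent ℚ R := by
  classical
  rw [linearIndependent_iff]
  intro l hl
  by_contra hne
  obtain ⟨α, hα, hmax⟩ :=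
    Finset.exists_max_image l.support colSum (Finsupp.support_nonempty_iff.2 hne)
  have h := congrArg
    (fun f => basisF.repr f (compOfSet (skewSize α []) (revDes (rowFilling α)))) hl
  simp only [Finsupp.linearCombination_apply, Finsupp.sum, map_sum, map_smul, map_zero,
    Finsupp.finsetSum_apply, Finsupp.smul_apply, basisF_repr_R, smul_eq_mul,
    Finsupp.zero_apply] at h
  rw [Finset.sum_eq_single α] at h
  · rcases mul_eq_zero.1 h with h | h
    · exact Finsupp.mem_support_iff.1 hα h
    · rw [Nat.cast_eq_zero, Finset.card_eq_zero] at h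
      exact Finset.filter_eq_empty_iff.1 h
        (Finset.mem_univ (⟨rowFilling α, isSYRT_rowFilling α⟩ : SYRT α [])) rfl
  · intro β hβ hne'
    rw [Finset.card_eq_zero.2, Nat.cast_zero, mul_zero]
    refine Finset.filter_eq_empty_iff.2 fun T _ hT => hne' ?_
    obtain ⟨h1, h2⟩ := compOfSet_inj (revDes_subset _) (revDes_subset _) hT
    rw [skewSize_nil, skewSize_nil] at h1
    exact eq_of_revDes_eq T.2 h1 h2 (hmax β hβ)
  · exact fun h' => absurd hα h'

/-- Linear independence gives functionals dual to the R_β; applied to the left tensor factor they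
extract the right-hand coefficients. -/
theorem sum_R_tmul_injective {f g : Comp →₀ QSym}
    (h : (f.sum fun β q => R β ⊗ₜ[ℚ] q) = g.sum fun β q => R β ⊗ₜ[ℚ] q) : f = g := by
  classical
  obtain ⟨p, hp⟩ := (Finsupp.linearCombination ℚ R).exists_leftInverse_of_injective
    (LinearMap.ker_eq_bot.2 linearIndependent_R)
  have hp' : ∀ α, p (R α) = Finsupp.single α 1 := fun α => by
    have := LinearMap.congr_fun hp (Finsupp.single α 1)
    simpa using this
  have key : ∀ (f : Comp →₀ QSym) (α : Comp),
      TensorProduct.lid ℚ QSym (TensorProduct.map ((Finsupp.lapply α).comp p) LinearMap.id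
        (f.sum fun β q => R β ⊗ₜ[ℚ] q)) = f α := by
    intro f α
    rw [Finsupp.sum, map_sum, map_sum]
    simp only [TensorProduct.map_tmul, LinearMap.comp_apply, hp', Finsupp.lapply_apply,
      LinearMap.id_apply, TensorProduct.lid_tmul, Finsupp.single_apply, ite_smul, one_smul,
      zero_smul, Finset.sum_ite_eq', Finsupp.mem_support_iff]
    split_ifs with h0
    · rfl
    · exact (not_not.1 h0).symm
  ext1 α
  rw [← key f, ← key g, h]

/-! ### The skew functions -/

/-- The family of the skew functions `R_{α // β}`. -/
noncomputable def skewFamily (α : Comp) : Comp →₀ QSym :=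
  Finsupp.indicator (finite_contained α).toFinset fun β _ => skewR α β

theorem isSkewFamily_skewFamily : IsSkewFamily skewFamily := by
  intro α
  rw [Δ_R, skewFamily, Finsupp.sum_of_support_subset _ (Finsupp.support_indicator_subset _ _) _ fun β _ =>
    TensorProduct.tmul_zero _ _]
  refine Finset.sum_congr rfl fun β hβ => ?_
  rw [Finsupp.indicator_of_mem hβ]

theorem IsSkewFamily.eq_skewFamily {S : Comp → Comp →₀ QSym} (hS : IsSkewFamily S) :
    S = skewFamily :=
  funext fun α => sum_R_tmul_injective ((hS α).symm.trans (isSkewFamily_skewFamily α))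

end YRS

theorem mainTheorem4 :
    (∃! S : YRS.Comp → YRS.Comp →₀ YRS.QSym, YRS.IsSkewFamily S) ∧
    ∀ S : YRS.Comp → YRS.Comp →₀ YRS.QSym, YRS.IsSkewFamily S →
      ∀ α β : YRS.Comp, YRS.Contained β α →
        ((S α β : YRS.QSym) : MvPowerSeries ℕ+ ℚ) = YRS.ssyrtGenFun α β ∧
        S α β = ∑ T : YRS.SYRT α β,
          YRS.F (YRS.compOfSet (YRS.skewSize α β) (YRS.revDes T.1)) := by
  refine ⟨⟨YRS.skewFamily, YRS.isSkewFamily_skewFamily, fun S hS => hS.eq_skewFamily⟩,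
    fun S hS α β h => ?_⟩
  have hβ : β ∈ (YRS.finite_contained α).toFinset := by simpa using h
  have e : S α β = YRS.skewR α β := by
    rw [hS.eq_skewFamily, YRS.skewFamily, Finsupp.indicator_of_mem hβ]
  rw [e]
  exact ⟨rfl, YRS.ssyrtGenFun_eq_sum_F α β⟩
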